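/- For an algebraic torus $T$ over $\mathbb{Q}$ of dimension $n$, let $X^*(T)$ be its character group, a free $\mathbb{Z}$-module of rank $n$ on which $G_{\mathbb{Q}}=\operatorname{Gal}(\overline{\mathbb{Q}}/\mathbb{Q})$ acts. Let $G_T\le \operatorname{GL}_n(\mathbb{Z})$ be the (finite) image of the resulting homomorphism $\rho_T: G_{\mathbb{Q}}\to\operatorname{Aut}(X^*(T))\cong\operatorname{GL}_n(\mathbb{Z})$, which is well defined up to conjugation, and let $C(T)$ be the Artin conductor of the rational representation of $G_{\mathbb{Q}}$ on $X^*(T)\otimes\mathbb{Q}$. Let $N_n^{\operatorname{tor}}(X)$ be the number of isomorphism classes of $n$-dimensional tori $T$ over $\mathbb{Q}$ with $C(T)\le X$, and for a finite subgroup $H\ne 1$ of $\operatorname{GL}_n(\mathbb{Z})$ let $N_n^{\operatorname{tor}}(X;H)$ be the number of those among them for which $G_T$ is conjugate to $H$ in $\operatorname{GL}_n(\mathbb{Z})$. Put $$a(H)=\min_{h\in H\setminus\{I_n\}}\operatorname{rank}(h-I_n),$$ and let $b(H)$ be the number of orbits $\mathcal{C}$ of the action of $G_{\mathbb{Q}}$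 on the conjugacy classes of $H$ via the cyclotomic character such that $\operatorname{rank}(h-I_n)=a(H)$ for some (equivalently, all) $h\in\mathcal{C}$. **Corollary.** Let $n\ge 1$. Suppose that for every finite subgroup $H\neq 1$ of $\operatorname{GL}_n(\mathbb{Z})$ there is a constant $c_H>0$ such that $$N_n^{\operatorname{tor}}(X;H)\sim c_H\,X^{\frac{1}{a(H)}}(\log X)^{b(H)-1}\qquad (X\to\infty).$$ Then there is a constant $c_n>0$ such that $$N_n^{\operatorname{tor}}(X)\sim c_n\,X(\log X)^{n-1}\qquad (X\to\infty).$$ In particular, if the hypothesis holds for every $n\ge1$, then so does the conclusion. -/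

import Mathlib

open scoped TensorProduct NumberField

noncomputable section

/-! ### Algebraic tori over `ℚ` and their character lattices -/

/-- The fixed algebraic closure of `ℚ`. -/
abbrev QBar : Type := AlgebraicClosure ℚ

instance : Algebra.IsAlgebraic ℚ QBar := AlgebraicClosure.isAlgebraic ℚ

instance : IsAlgClosure ℚ QBar := ⟨inferInstance, inferInstance⟩

/-- The absolute Galois group of `ℚ`. -/
abbrev GalQ : Type := Gal(QBar/ℚ)

/-- An `n`-dimensional algebraic torus `T` over `ℚ`, given by its coordinate ring: a commutative
Hopf algebra over `ℚ` (that is, an affine group scheme over `ℚ`) which over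
`QBar` becomes isomorphic, as a Hopf algebra, to the Laurent polynomial ring in `n` variables
(that is, `T` becomes isomorphic to `𝔾ₘⁿ` as a group scheme). A bialgebra isomorphism between Hopf
algebras automatically respects the antipodes. -/
structure RatTorus (n : ℕ) where
  /-- The coordinate ring of the torus. -/
  coordRing : Type
  [commRing : CommRing coordRing]
  [hopfAlgebra : HopfAlgebra ℚ coordRing]
  split : Nonempty ((QBar ⊗[ℚ] coordRing) ≃ₐc[QBar] (AddMonoidAlgebra QBar (Fin n → ℤ)))

attribute [instance] RatTorus.commRing RatTorus.hopfAlgebra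

namespace RatTorus

variable {n : ℕ}

/-- Two tori over `ℚ` are isomorphic when their coordinate Hopf algebras are. -/
instance isoSetoid (n : ℕ) : Setoid (RatTorus n) where
  r T T' := Nonempty (T.coordRing ≃ₐc[ℚ] T'.coordRing)
  iseqv :=
    { refl := fun T => ⟨BialgEquiv.refl ℚ T.coordRing⟩
      symm := fun ⟨e⟩ => ⟨e.symm⟩
      trans := fun ⟨e⟩ ⟨e'⟩ => ⟨e.trans e'⟩ }

/-- The isomorphism classes of `n`-dimensional tori over `ℚ`. -/
abbrev IsoClass (n : ℕ) : Type 1 := Quotient (isoSetoid n)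

/-- The character group `X^*(T) = Hom(T_QBar, 𝔾ₘ)`, written multiplicatively: homomorphisms of
group schemes to `𝔾ₘ` are the group-like elements of the coordinate ring of `T_QBar`. -/
def Characters (T : RatTorus n) : Type := GroupLike QBar (QBar ⊗[ℚ] T.coordRing)

instance (T : RatTorus n) : CommGroup T.Characters :=
  inferInstanceAs (CommGroup (GroupLike QBar (QBar ⊗[ℚ] T.coordRing)))

/-- The action `σ ⊗ id` of a Galois automorphism on the coordinate ring of `T_QBar`. -/
def galMap (T : RatTorus n) (σ : GalQ) :
    (QBar ⊗[ℚ] T.coordRing) →ₐ[ℚ] (QBar ⊗[ℚ] T.coordRing) :=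
  Algebra.TensorProduct.map (σ : QBar →ₐ[ℚ] QBar) (AlgHom.id ℚ T.coordRing)

@[simp] theorem galMap_tmul (T : RatTorus n) (σ : GalQ) (c : QBar) (a : T.coordRing) :
    T.galMap σ (c ⊗ₜ a) = σ c ⊗ₜ a := by
  simp [galMap]

theorem galMap_smul (T : RatTorus n) (σ : GalQ) (c : QBar) (z : QBar ⊗[ℚ] T.coordRing) :
    T.galMap σ (c • z) = σ c • T.galMap σ z := by
  induction z with
  | zero => simp
  | add x y hx hy => simp only [smul_add, map_add, hx, hy]
  | tmul d a => simp [TensorProduct.smul_tmul']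

theorem galMap_isGroupLikeElem (T : RatTorus n) (σ : GalQ) {z : QBar ⊗[ℚ] T.coordRing}
    (hz : IsGroupLikeElem QBar z) : IsGroupLikeElem QBar (T.galMap σ z) := by
  constructor
  · have key : ∀ w : QBar ⊗[ℚ] T.coordRing,
        Coalgebra.counit (R := QBar) (T.galMap σ w) = σ (Coalgebra.counit (R := QBar) w) := by
      intro w
      induction w with
      | zero => simp
      | add x y hx hy => simp only [map_add, hx, hy]
      | tmul d a => simp [Algebra.smul_def]
    rw [key, hz.counit_eq_one, map_one]
  · let Φ : ((QBar ⊗[ℚ] T.coordRing) ⊗[QBar] (QBar ⊗[ℚ] T.coordRing)) →+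
        ((QBar ⊗[ℚ] T.coordRing) ⊗[QBar] (QBar ⊗[ℚ] T.coordRing)) :=
      TensorProduct.liftAddHom
        { toFun := fun x =>
            { toFun := fun y => T.galMap σ x ⊗ₜ[QBar] T.galMap σ y
              map_zero' := by simp
              map_add' := fun y y' => by simp [TensorProduct.tmul_add] }
          map_zero' := by ext; simp
          map_add' := fun x x' => by ext; simp [TensorProduct.add_tmul] }
        (fun r x y => by simp [galMap_smul, TensorProduct.smul_tmul])
    have hΦ : ∀ x y, Φ (x ⊗ₜ y) = T.galMap σ x ⊗ₜ[QBar] T.galMap σ y := fun x y => by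
      simp [Φ]
    have key : ∀ w : QBar ⊗[ℚ] T.coordRing,
        Coalgebra.comul (R := QBar) (T.galMap σ w) = Φ (Coalgebra.comul (R := QBar) w) := by
      intro w
      induction w with
      | zero => simp
      | add x y hx hy => simp only [map_add, hx, hy]
      | tmul d a =>
        simp only [galMap_tmul, TensorProduct.comul_tmul, CommSemiring.comul_apply]
        induction (Coalgebra.comul (R := ℚ) a) with
        | zero => simp
        | add x y hx hy => simp only [TensorProduct.tmul_add, map_add, hx, hy]
        | tmul a b => simp [hΦ]
    rw [key, hz.comul_eq_tmul_self, hΦ]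

/-- The Galois action on the character group. -/
instance (T : RatTorus n) : MulDistribMulAction GalQ T.Characters where
  smul σ χ := ⟨T.galMap σ (GroupLike.val χ),
    T.galMap_isGroupLikeElem σ (GroupLike.isGroupLikeElem_val χ)⟩
  one_smul χ := by
    apply GroupLike.val_injective
    change T.galMap 1 (GroupLike.val χ) = (GroupLike.val χ)
    have : T.galMap 1 = AlgHom.id ℚ _ := by
      apply Algebra.TensorProduct.ext' ; intro c a; simp
    rw [this]; rfl
  mul_smul σ τ χ := by
    apply GroupLike.val_injective
    change T.galMap (σ * τ) (GroupLike.val χ) = T.galMap σ (T.galMap τ (GroupLike.val χ))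
    have : T.galMap (σ * τ) = (T.galMap σ).comp (T.galMap τ) := by
      apply Algebra.TensorProduct.ext' ; intro c a; simp
    rw [this]; rfl
  smul_mul σ χ ψ := by
    apply GroupLike.val_injective
    exact map_mul (T.galMap σ) (GroupLike.val χ) (GroupLike.val ψ)
  smul_one σ := by
    apply GroupLike.val_injective
    exact map_one (T.galMap σ)

/-- The character group written additively: the character lattice, a free `ℤ`-module of rank `n`. -/
abbrev Lattice (T : RatTorus n) : Type := Additive T.Characters

/-- The Galois representation `GalQ → Aut(X^*(T))` on the character lattice. -/
def latticeRep (T : RatTorus n) : Representation ℤ GalQ T.Lattice :=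
  Representation.ofMulDistribMulAction GalQ T.Characters

/-- The rational Galois representation on `X^*(T) ⊗ ℚ`. -/
def rationalRep (T : RatTorus n) : Representation ℚ GalQ (ℚ ⊗[ℤ] T.Lattice) where
  toFun σ := (T.latticeRep σ).baseChange ℚ
  map_one' := by rw [map_one]; exact LinearMap.baseChange_id
  map_mul' σ τ := by rw [map_mul]; exact LinearMap.baseChange_comp _ _

/-- The representation `ρ_T : GalQ → GL_n(ℤ)` with respect to a basis of the character lattice. -/
def matrixRep (T : RatTorus n) (b : Module.Basis (Fin n) ℤ T.Lattice) : GalQ →* GL (Fin n) ℤ :=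
  ((LinearMap.toMatrixAlgEquiv b : Module.End ℤ T.Lattice →* Matrix (Fin n) (Fin n) ℤ).comp
    T.latticeRep).toHomUnits

/-- `G_T`, the image of `ρ_T`, is conjugate to `H` in `GL_n(ℤ)`. -/
def HasType (T : RatTorus n) (H : Subgroup (GL (Fin n) ℤ)) : Prop :=
  ∃ (b : Module.Basis (Fin n) ℤ T.Lattice) (g : GL (Fin n) ℤ),
    (T.matrixRep b).range.map (MulAut.conj g).toMonoidHom = H

end RatTorus

/-! ### Artin conductors -/

/-- The `i`-th ramification group (lower numbering) of `L/ℚ` at an ideal `P` of the ring of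
integers of `L`: the `σ` acting trivially on `𝓞 L / P ^ (i + 1)`. -/
def ramificationSubgroup (L : Type*) [Field L] [Algebra ℚ L] (P : Ideal (𝓞 L)) (i : ℕ) :
    Subgroup Gal(L/ℚ) :=
  (P ^ (i + 1)).inertia Gal(L/ℚ)

namespace Representation

variable {V : Type*} [AddCommGroup V] [Module ℚ V]

/-- The field cut out by a representation of `GalQ`: the fixed field of its kernel. For the
representation on the character lattice of a torus this is the splitting field, a finite
Galois extension of `ℚ`. -/
def cutField (ρ : Representation ℚ GalQ V) : IntermediateField ℚ QBar :=
  IntermediateField.fixedField ρ.ker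

instance (ρ : Representation ℚ GalQ V) : IsGalois ℚ ρ.cutField :=
  IsGalois.of_fixedField_normal_subgroup ρ.ker

/-- The subspace of `V` fixed by a subgroup `D` of `Gal(L/ℚ)`, where `L` is the field cut out by
`ρ` and `Gal(L/ℚ) = GalQ / ker ρ` acts on `V`. -/
def fixedBy (ρ : Representation ℚ GalQ V) (D : Subgroup Gal(ρ.cutField/ℚ)) : Submodule ℚ V :=
  Representation.invariants
    (ρ.comp (D.comap (AlgEquiv.restrictNormalHom (K₁ := QBar) ρ.cutField)).subtype)

/-- The exponent of the Artin conductor at a prime `P` of the field cut out by `ρ`: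
`∑ i ≥ 0, |G_i| / |G_0| * codim V^{G_i}`. Only finitely many terms are nonzero. -/
def artinExponent (ρ : Representation ℚ GalQ V) (P : Ideal (𝓞 ρ.cutField)) : ℚ :=
  ∑ᶠ i : ℕ, (Nat.card (ramificationSubgroup ρ.cutField P i) : ℚ) /
    (Nat.card (ramificationSubgroup ρ.cutField P 0) : ℚ) *
      ((Module.finrank ℚ V : ℚ) -
        Module.finrank ℚ (ρ.fixedBy (ramificationSubgroup ρ.cutField P i)))

instance (p : Nat.Primes) : (Ideal.span {((p : ℕ) : ℤ)}).IsPrime :=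
  (Ideal.span_singleton_prime (by exact_mod_cast p.2.ne_zero)).2
    (Nat.prime_iff_prime_int.1 p.2)

/-- A prime of the ring of integers of `L` above the rational prime `p`. -/
def primeAbove (L : Type*) [Field L] [CharZero L] (p : Nat.Primes) : Ideal (𝓞 L) :=
  (Classical.arbitrary ((Ideal.span {((p : ℕ) : ℤ)}).primesOver (𝓞 L)) :
    (Ideal.span {((p : ℕ) : ℤ)}).primesOver (𝓞 L)).1

/-- The Artin conductor `∏ p ^ (f_p)`, where `f_p` is the exponent at a prime above `p` (all
primes above `p` are conjugate and give the same exponent). Only ramified primes contribute. It is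
a positive integer, here regarded as a real number. -/
def artinConductor (ρ : Representation ℚ GalQ V) : ℝ :=
  ∏ᶠ p : Nat.Primes, ((p : ℕ) : ℝ) ^ (ρ.artinExponent (primeAbove ρ.cutField p) : ℝ)

end Representation

/-! ### Counting tori -/

namespace RatTorus

/-- The Artin conductor `C(T)` of a torus. -/
def conductor {n : ℕ} (T : RatTorus n) : ℝ := T.rationalRep.artinConductor

/-- The number of isomorphism classes of `n`-dimensional tori `T` over `ℚ` with `C(T) ≤ X`. -/
def count (n : ℕ) (X : ℝ) : ℕ :=
  Set.ncard {t : IsoClass n | ∃ T : RatTorus n, (⟦T⟧ : IsoClass n) = t ∧ T.conductor ≤ X}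

/-- The number of isomorphism classes of `n`-dimensional tori `T` over `ℚ` with `C(T) ≤ X` such
that `G_T` is conjugate to `H` in `GL_n(ℤ)`. -/
def countOfType (n : ℕ) (H : Subgroup (GL (Fin n) ℤ)) (X : ℝ) : ℕ :=
  Set.ncard {t : IsoClass n |
    ∃ T : RatTorus n, (⟦T⟧ : IsoClass n) = t ∧ T.HasType H ∧ T.conductor ≤ X}

end RatTorus

/-! ### The invariants `a(H)` and `b(H)` -/

/-- The mod `m` cyclotomic character of `GalQ`: `σ ζ = ζ ^ χ(σ)` for all `m`-th roots of unity. -/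
def cycloChar (m : ℕ) [NeZero m] : GalQ →* (ZMod m)ˣ :=
  (modularCyclotomicCharacter QBar (HasEnoughRootsOfUnity.natCard_rootsOfUnity QBar m)).comp
    (MulSemiringAction.toRingAut GalQ QBar)

/-- The `k`-th power map on conjugacy classes. -/
def ConjClasses.powMap {G : Type*} [Group G] (k : ℕ) : ConjClasses G → ConjClasses G :=
  Quotient.map (fun g => g ^ k) (fun _ _ h => h.pow k)

/-- The action of `GalQ` on the conjugacy classes of a finite group via the cyclotomic character:
`σ` sends the class of `g` to the class of `g ^ χ(σ)`. -/
@[reducible]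
def cyclotomicAction (G : Type*) [Group G] [Finite G] : MulAction GalQ (ConjClasses G) where
  smul σ C := C.powMap (cycloChar (Nat.card G) σ : ZMod (Nat.card G)).val
  one_smul C := by
    induction C using Quotient.inductionOn with
    | _ g =>
      change ConjClasses.mk (g ^ _) = ConjClasses.mk g
      congr 1
      rw [map_one, Units.val_one]
      conv_rhs => rw [← pow_one g]
      rw [ZMod.val_one_eq_one_mod]
      exact pow_mod_natCard g 1
  mul_smul σ τ C := by
    induction C using Quotient.inductionOn with
    | _ g =>
      change ConjClasses.mk (g ^ _) = ConjClasses.mk ((g ^ _) ^ _)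
      congr 1
      rw [map_mul, Units.val_mul, ZMod.val_mul, pow_mod_natCard, mul_comm, pow_mul]

/-- `a(H)`: the minimum of `rank (h - 1)` over `h ∈ H`, `h ≠ 1`. -/
def malleA {n : ℕ} (H : Subgroup (GL (Fin n) ℤ)) : ℕ :=
  sInf {r : ℕ | ∃ h ∈ H, h ≠ 1 ∧ r = ((h : Matrix (Fin n) (Fin n) ℤ) - 1).rank}

/-- `b(H)`: the number of orbits of `GalQ` on the conjugacy classes of `H`, acting via the
cyclotomic character, that contain (the class of) some `h` with `rank (h - 1) = a(H)`. -/
def malleB {n : ℕ} (H : Subgroup (GL (Fin n) ℤ)) [Finite H] : ℕ :=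
  letI := cyclotomicAction H
  Set.ncard {O : MulAction.orbitRel.Quotient GalQ (ConjClasses H) |
    ∃ h : H, ConjClasses.mk h ∈ O.orbit ∧
      (((h : GL (Fin n) ℤ) : Matrix (Fin n) (Fin n) ℤ) - 1).rank = malleA H}

end

/-!
Every torus has a finite image `G_T`, well defined up to conjugacy, so `N(X)` is the sum of the
`N(X; H)` over the conjugacy classes of finite subgroups `H` of `GL_n(ℤ)`, and the claim
follows by adding up the asymptotics, provided that

* there are finitely many such classes (`exists_finite_set_of_conjugates`);
* the classes with `a(H) ≠ 1` are negligible (`tendsto_rpow_mul_log_pow_div_zero`);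
* the classes with `a(H) = 1` have `b(H) ≤ n` (`malleB_le_of_malleA_eq_one`), so that no term grows
  faster than `X (log X) ^ (n - 1)`, while `b(H) = n` for the group of diagonal sign matrices
  (`le_malleB_range_signDiagonalHom`), so that this order of growth is attained;
* the trivial group, to which the hypothesis does not apply, contributes at most one torus
  (`RatTorus.equiv_of_hasType_bot`).

Finiteness is Jordan's theorem. A lattice with an action of a finite group has a basis in which
the group acts by matrices bounded in terms of the rank (`exists_bounded_basis`). For an irreducible
lattice, the shortest vectors for an invariant form span a sublattice whose quotient has bounded
exponent, and by Cramer's rule they have bounded coefficients with respect to a tuple of them with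
maximal determinant. For a reducible one, a basis is put together from bases of an invariant
sublattice and of its quotient, with a section that is equivariant up to a bounded error.

For the bound on `b(H)`, an element `h` of finite order with `rank (h - 1) = 1` is a reflection, and
if one picks in each conjugacy class of reflections a root with the least positive value under a
generic linear form, the chosen roots are pairwise obtuse in an open half space, hence linearly
independent (`exists_linearIndependent_roots`).

The last point is Galois descent: if all characters are Galois-fixed, they are defined over `ℚ`
and identify the coordinate ring with the group algebra of `ℤⁿ`.

The cardinalities in the statement are those of `Set.ncard`, which is `0` for infinite sets. That
the sets in question are finite follows from the hypothesis itself, because its right-hand side is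
eventually nonzero and the sets grow with `X`.
-/

/-! ### Bounded bases of lattices with a finite group action -/

section BoundedBases

open Module

theorem finite_submodules_of_single_mem (n K : ℕ) (hK : 0 < K) :
    {N : Submodule ℤ (Fin n → ℤ) | ∀ i, Pi.single i (K : ℤ) ∈ N}.Finite := by
  have : NeZero K := ⟨hK.ne'⟩
  let F : Submodule ℤ (Fin n → ℤ) → Set (Fin n → ZMod K) :=
    fun N => (fun z i => (z i : ZMod K)) '' (N : Set (Fin n → ℤ))
  refine Set.Finite.of_finite_image (f := F) (Set.toFinite _) ?_
  have key : ∀ N : Submodule ℤ (Fin n → ℤ), (∀ i, Pi.single i (K : ℤ) ∈ N) →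
      ∀ z, z ∈ N ↔ (fun i => (z i : ZMod K)) ∈ F N := by
    intro N hN z
    refine ⟨fun hz => ⟨z, hz, rfl⟩, ?_⟩
    rintro ⟨w, hw, hwz⟩
    have h1 : ∀ i, ∃ u, z i - w i = (K : ℤ) * u := fun i =>
      (ZMod.intCast_eq_intCast_iff_dvd_sub _ _ _).1 (congrFun hwz i)
    choose u hu using h1
    have h2 : z = w + ∑ i, u i • Pi.single (M := fun _ => ℤ) i (K : ℤ) := by
      ext i
      simp only [Pi.add_apply, Finset.sum_apply, Pi.smul_apply, Pi.single_apply, smul_eq_mul,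
        mul_ite, mul_zero, Finset.sum_ite_eq, Finset.mem_univ, if_true]
      linarith [hu i]
    rw [h2]
    exact N.add_mem hw (N.sum_mem fun i _ => N.smul_mem _ (hN i))
  intro N hN N' hN' h
  ext z
  rw [key N hN, key N' hN', h]

/-- The sublattices of `ℤⁿ` that contain `Kℤⁿ` have bases with uniformly bounded entries, in which
the coordinates of a vector are uniformly bounded by its entries. -/
theorem exists_bounded_basis_submodule (n K : ℕ) (hK : 0 < K) :
    ∃ C : ℕ, ∀ N : Submodule ℤ (Fin n → ℤ), (∀ i, Pi.single i (K : ℤ) ∈ N) →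
      ∃ β : Basis (Fin n) ℤ N, (∀ j l, |(β j : Fin n → ℤ) l| ≤ C) ∧
        ∀ (z : N) i, |β.repr z i| ≤ C * ∑ l, |(z : Fin n → ℤ) l| := by
  have hfin := finite_submodules_of_single_mem n K hK
  have hone : ∀ N : Submodule ℤ (Fin n → ℤ), ∃ C : ℕ, (∀ i, Pi.single i (K : ℤ) ∈ N) →
      ∃ β : Basis (Fin n) ℤ N, (∀ j l, |(β j : Fin n → ℤ) l| ≤ C) ∧
        ∀ (z : N) i, |β.repr z i| ≤ C * ∑ l, |(z : Fin n → ℤ) l| := by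
    intro N
    by_cases hN : ∀ i, Pi.single i (K : ℤ) ∈ N
    swap
    · exact ⟨0, fun h => absurd h hN⟩
    have hrank : finrank ℤ N = n := by
      apply le_antisymm
      · simpa using Submodule.finrank_le N
      · have hli : LinearIndependent ℤ (fun i : Fin n => (⟨Pi.single i (K : ℤ), hN i⟩ : N)) := by
          rw [Fintype.linearIndependent_iff]
          intro g hg i
          have := congrFun (congrArg (Subtype.val) hg) i
          simp [Finset.sum_apply, Pi.single_apply] at this
          rcases this with h | h
          · exact h
          · omega
        simpa using hli.fintype_card_le_finrank
    let β : Basis (Fin n) ℤ N := finBasisOfFinrankEq ℤ N hrank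
    obtain ⟨A, hA⟩ : ∃ A : ℕ, ∀ j l, |(β j : Fin n → ℤ) l| ≤ A := by
      refine ⟨∑ j, ∑ l, ((β j : Fin n → ℤ) l).natAbs, fun j l => ?_⟩
      rw [Int.abs_eq_natAbs]
      exact_mod_cast (Finset.single_le_sum (f := fun l => ((β j : Fin n → ℤ) l).natAbs)
        (fun _ _ => Nat.zero_le _) (Finset.mem_univ l)).trans
        (Finset.single_le_sum (f := fun j => ∑ l, ((β j : Fin n → ℤ) l).natAbs)
        (fun _ _ => Nat.zero_le _) (Finset.mem_univ j))
    obtain ⟨B, hB⟩ : ∃ B : ℕ, ∀ i l, |β.repr ⟨Pi.single l (K : ℤ), hN l⟩ i| ≤ B := by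
      refine ⟨∑ i, ∑ l, (β.repr ⟨Pi.single l (K : ℤ), hN l⟩ i).natAbs, fun i l => ?_⟩
      rw [Int.abs_eq_natAbs]
      exact_mod_cast (Finset.single_le_sum
        (f := fun l => (β.repr ⟨Pi.single l (K : ℤ), hN l⟩ i).natAbs)
        (fun _ _ => Nat.zero_le _) (Finset.mem_univ l)).trans
        (Finset.single_le_sum (f := fun i => ∑ l, (β.repr ⟨Pi.single l (K : ℤ), hN l⟩ i).natAbs)
        (fun _ _ => Nat.zero_le _) (Finset.mem_univ i))
    refine ⟨A + B, fun _ => ⟨β, fun j l => (hA j l).trans (by push_cast; omega), fun z i => ?_⟩⟩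
    have hz : (K : ℤ) • z = ∑ l, (z : Fin n → ℤ) l • (⟨Pi.single l (K : ℤ), hN l⟩ : N) := by
      ext i
      simp [Finset.sum_apply, Pi.single_apply, mul_comm]
    have hz' : (K : ℤ) * β.repr z i =
        ∑ l, (z : Fin n → ℤ) l * β.repr ⟨Pi.single l (K : ℤ), hN l⟩ i := by
      have := congrArg (fun w => β.repr w i) hz
      simpa only [map_smul, map_sum, Finsupp.smul_apply, Finsupp.finsetSum_apply, smul_eq_mul]
        using this
    have hK1 : (1 : ℤ) ≤ K := by exact_mod_cast hK
    calc |β.repr z i| ≤ K * |β.repr z i| := le_mul_of_one_le_left (abs_nonneg _) hK1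
      _ = |(K : ℤ) * β.repr z i| := by rw [abs_mul, abs_of_nonneg (by omega : (0 : ℤ) ≤ K)]
      _ ≤ ∑ l, |(z : Fin n → ℤ) l * β.repr ⟨Pi.single l (K : ℤ), hN l⟩ i| := by
          rw [hz']; exact Finset.abs_sum_le_sum_abs _ _
      _ ≤ ∑ l, ((A + B : ℕ) : ℤ) * |(z : Fin n → ℤ) l| := by
          refine Finset.sum_le_sum fun l _ => ?_
          rw [abs_mul, mul_comm]
          exact mul_le_mul_of_nonneg_right ((hB i l).trans (by push_cast; omega)) (abs_nonneg _)
      _ = _ := by rw [Finset.mul_sum]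
  choose C hC using hone
  refine ⟨∑ N ∈ hfin.toFinset, C N, fun N hN => ?_⟩
  obtain ⟨β, h1, h2⟩ := hC N hN
  have hle : (C N : ℤ) ≤ (∑ N ∈ hfin.toFinset, C N : ℕ) := by
    exact_mod_cast Finset.single_le_sum (f := C) (fun _ _ => Nat.zero_le _)
      (hfin.mem_toFinset.2 hN)
  exact ⟨β, fun j l => (h1 j l).trans hle, fun z i => (h2 z i).trans
    (mul_le_mul_of_nonneg_right hle (Finset.sum_nonneg fun _ _ => abs_nonneg _))⟩

variable {L G : Type} [AddCommGroup L] [Group G] {n : ℕ}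

/-- A finite group acting on a lattice preserves a positive definite integral quadratic form,
the sum of the squares of the coordinates of the translates of a vector. -/
theorem exists_invariant_form [Finite G] (e : Basis (Fin n) ℤ L) (ρ : Representation ℤ G L) :
    ∃ Q : L → ℤ, (∀ g x, Q (ρ g x) = Q x) ∧ (∀ x, 0 ≤ Q x) ∧ (∀ x, Q x = 0 → x = 0) ∧
      (∀ (c : ℤ) x, Q (c • x) = c ^ 2 * Q x) ∧
      (∀ v : Fin n → L, Q (∑ i, v i) ≤ n * ∑ i, Q (v i)) ∧
      ∀ r, {x | Q x ≤ r}.Finite := by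
  have := Fintype.ofFinite G
  let Q : L → ℤ := fun x => ∑ g, ∑ i, (e.repr (ρ g x) i) ^ 2
  have hnn : ∀ g x, 0 ≤ ∑ i, (e.repr (ρ g x) i) ^ 2 := fun g x =>
    Finset.sum_nonneg fun i _ => sq_nonneg _
  have hle : ∀ x i, (e.repr x i) ^ 2 ≤ Q x := by
    intro x i
    calc (e.repr x i) ^ 2 ≤ ∑ i, (e.repr (ρ 1 x) i) ^ 2 := by
          simpa using Finset.single_le_sum (f := fun i => (e.repr x i) ^ 2)
            (fun i _ => sq_nonneg _) (Finset.mem_univ i)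
      _ ≤ Q x := Finset.single_le_sum (f := fun g => ∑ i, (e.repr (ρ g x) i) ^ 2)
            (fun g _ => hnn g x) (Finset.mem_univ 1)
  refine ⟨Q, ?_, fun x => Finset.sum_nonneg fun g _ => hnn g x, ?_, ?_, ?_, ?_⟩
  · intro g x
    refine Fintype.sum_equiv (Equiv.mulRight g) _ _ fun h => ?_
    simp [map_mul]
  · intro x hx
    apply e.repr.injective
    ext i
    have := hle x i
    rw [hx] at this
    simpa using pow_eq_zero_iff (two_ne_zero) |>.1 (le_antisymm this (sq_nonneg _))
  · intro c x
    simp [Q, Finset.mul_sum, mul_pow]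
  · intro v
    calc Q (∑ i, v i) = ∑ g, ∑ i, (∑ j, e.repr (ρ g (v j)) i) ^ 2 := by
          simp [Q, Finsupp.finsetSum_apply]
      _ ≤ ∑ g, ∑ i, n * ∑ j, (e.repr (ρ g (v j)) i) ^ 2 := by
          refine Finset.sum_le_sum fun g _ => Finset.sum_le_sum fun i _ => ?_
          simpa using sq_sum_le_card_mul_sum_sq (s := (Finset.univ : Finset (Fin n)))
            (f := fun j => e.repr (ρ g (v j)) i)
      _ = n * ∑ i, Q (v i) := by
          simp only [Q, ← Finset.mul_sum]
          congr 1
          conv_rhs => rw [Finset.sum_comm]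
          exact Finset.sum_congr rfl fun g _ => Finset.sum_comm
  · intro r
    refine Set.Finite.of_finite_image (f := fun x => (e.repr x : Fin n → ℤ)) ?_ ?_
    · refine (Set.Finite.pi' (ι := Fin n) (t := fun _ => Set.Icc (-r) r)
        fun _ => Set.finite_Icc _ _).subset ?_
      rintro _ ⟨x, hx, rfl⟩ i
      have h1 := (hle x i).trans hx
      have h2 : |e.repr x i| ≤ (e.repr x i) ^ 2 := by
        rw [← sq_abs]
        exact Int.le_self_sq _
      exact abs_le.1 (h2.trans h1)
    · intro x _ y _ h
      exact e.repr.injective (DFunLike.coe_injective h)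


/-- In an irreducible lattice, an invariant set containing a nonzero vector contains `n`
independent vectors. -/
theorem exists_det_ne_zero (e : Basis (Fin n) ℤ L) (ρ : Representation ℤ G L)
    (hirr : ∀ M : Submodule ℤ L, (∀ g, ∀ x ∈ M, ρ g x ∈ M) →
      (∀ (k : ℤ) (x : L), k ≠ 0 → k • x ∈ M → x ∈ M) → M = ⊥ ∨ M = ⊤)
    (S : Set L) (hS : ∀ g, ∀ x ∈ S, ρ g x ∈ S) (v₀ : L) (hv₀ : v₀ ∈ S) (hv₀0 : v₀ ≠ 0) :
    ∃ v : Fin n → L, (∀ i, v i ∈ S) ∧ (e.toMatrix v).det ≠ 0 := by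
  -- the saturation of the span of `S` is everything
  let M : Submodule ℤ L :=
    { carrier := {x | ∃ k : ℤ, k ≠ 0 ∧ k • x ∈ Submodule.span ℤ S}
      zero_mem' := ⟨1, one_ne_zero, by simp⟩
      add_mem' := by
        rintro x y ⟨k, hk, hx⟩ ⟨l, hl, hy⟩
        refine ⟨k * l, mul_ne_zero hk hl, ?_⟩
        rw [smul_add, mul_smul, mul_smul, smul_comm k l x]
        exact add_mem (Submodule.smul_mem _ _ hx) (Submodule.smul_mem _ _ hy)
      smul_mem' := by
        rintro c x ⟨k, hk, hx⟩
        exact ⟨k, hk, by rw [smul_comm]; exact Submodule.smul_mem _ _ hx⟩ }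
  have hM : M = ⊤ := by
    refine (hirr M ?_ ?_).resolve_left ?_
    · rintro g x ⟨k, hk, hx⟩
      refine ⟨k, hk, ?_⟩
      rw [← map_smul]
      have : Submodule.span ℤ S ≤ (Submodule.span ℤ S).comap (ρ g) :=
        Submodule.span_le.2 fun y hy => Submodule.subset_span (hS g y hy)
      exact this hx
    · rintro k x hk ⟨l, hl, hx⟩
      exact ⟨l * k, mul_ne_zero hl hk, by rwa [mul_smul]⟩
    · intro h
      have : v₀ ∈ M := ⟨1, one_ne_zero, by simpa using Submodule.subset_span hv₀⟩
      rw [h] at this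
      exact hv₀0 this
  let f : L →ₗ[ℤ] (Fin n → ℚ) :=
    { toFun := fun x i => (e.repr x i : ℚ)
      map_add' := fun x y => by ext; simp
      map_smul' := fun c x => by ext; simp }
  have hspan : Submodule.span ℚ (f '' S) = ⊤ := by
    have h1 : Submodule.span ℤ S ≤ ((Submodule.span ℚ (f '' S)).restrictScalars ℤ).comap f :=
      Submodule.span_le.2 fun y hy => Submodule.subset_span ⟨y, hy, rfl⟩
    rw [eq_top_iff, ← (Pi.basisFun ℚ (Fin n)).span_eq, Submodule.span_le]
    rintro _ ⟨i, rfl⟩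
    obtain ⟨k, hk, hx⟩ : e i ∈ M := hM ▸ Submodule.mem_top
    have h2 : f (k • e i) ∈ Submodule.span ℚ (f '' S) := h1 hx
    have h3 : f (k • e i) = (k : ℚ) • Pi.basisFun ℚ (Fin n) i := by
      ext j
      simp [f, Finsupp.single_apply, Pi.single_apply, eq_comm]
    rw [h3] at h2
    exact (Submodule.smul_mem_iff _ (by exact_mod_cast hk)).1 h2
  obtain ⟨b, hbS, hbspan, hbli⟩ := exists_linearIndependent ℚ (f '' S)
  let B : Basis b ℚ (Fin n → ℚ) := Basis.mk hbli (by
    rw [Subtype.range_coe, hbspan, hspan])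
  have : Fintype b := FiniteDimensional.fintypeBasisIndex B
  have hcard : Fintype.card b = n := by
    rw [← finrank_eq_card_basis B]; simp
  let eq : Fin n ≃ b := (Fintype.equivFinOfCardEq hcard).symm
  choose v hvS hv using fun i : Fin n => hbS (eq i).2
  refine ⟨v, hvS, fun hdet => ?_⟩
  have hli : LinearIndependent ℚ (fun i => f (v i)) := by
    simp_rw [hv]
    exact hbli.comp eq eq.injective
  have hA : ((e.toMatrix v).map (Int.castRingHom ℚ)).det ≠ 0 := by
    have h1 : LinearIndependent ℚ ((e.toMatrix v).map (Int.castRingHom ℚ)).col := hli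
    have := Matrix.linearIndependent_cols_iff_isUnit.1 h1
    exact ((Matrix.isUnit_iff_isUnit_det _).1 this).ne_zero
  apply hA
  rw [← RingHom.mapMatrix_apply, ← RingHom.map_det, hdet, map_zero]

/-- With respect to a tuple `v` from a finite set `S` whose determinant `d` has maximal absolute
value, all vectors `w` of `S` have coefficients `δ w i / d` of absolute value at most `1`: by
Cramer's rule, `δ w i` is the determinant of the tuple in which `w` replaces `v i`. -/
theorem exists_coefficients_le (e : Basis (Fin n) ℤ L) (S : Set L) (hfin : S.Finite)
    (hS : ∃ v : Fin n → L, (∀ i, v i ∈ S) ∧ (e.toMatrix v).det ≠ 0) :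
    ∃ (v : Fin n → L) (d : ℤ) (δ : L →ₗ[ℤ] (Fin n → ℤ)), (∀ i, v i ∈ S) ∧ d ≠ 0 ∧
      LinearIndependent ℤ v ∧ (∀ w, d • w = ∑ i, δ w i • v i) ∧ ∀ w ∈ S, ∀ i, |δ w i| ≤ |d| := by
  have hfin' : {v : Fin n → L | (∀ i, v i ∈ S) ∧ (e.toMatrix v).det ≠ 0}.Finite :=
    (Set.Finite.pi' fun _ => hfin).subset fun v hv => hv.1
  obtain ⟨v, ⟨hvS, hv⟩, hmax⟩ := Set.exists_max_image _
    (fun v => |(e.toMatrix v).det|) hfin' hS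
  let A := e.toMatrix v
  let δ : L →ₗ[ℤ] (Fin n → ℤ) :=
    (Matrix.mulVecLin A.adjugate) ∘ₗ e.equivFun.toLinearMap
  have hδ : ∀ w, δ w = A.cramer (e.repr w) := fun w => by
    rw [Matrix.cramer_eq_adjugate_mulVec]; rfl
  have hsum : ∀ (c : Fin n → ℤ) k, e.repr (∑ i, c i • v i) k = (A.mulVec c) k := by
    intro c k
    simp [Matrix.mulVec, dotProduct, A, Basis.toMatrix_apply, mul_comm, Finsupp.finsetSum_apply]
  refine ⟨v, A.det, δ, hvS, hv, ?_, ?_, ?_⟩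
  · rw [Fintype.linearIndependent_iff]
    intro c hc
    have : A.mulVec c = 0 := by
      ext k
      rw [← hsum, hc]; simp
    exact congrFun (Matrix.eq_zero_of_mulVec_eq_zero hv this)
  · intro w
    apply e.repr.injective
    ext k
    rw [hsum, hδ, Matrix.mulVec_cramer]
    simp
  · intro w hw i
    rw [hδ, Matrix.cramer_apply, ← Basis.toMatrix_update]
    by_cases h0 : (e.toMatrix (Function.update v i w)).det = 0
    · rw [h0]; simp
    · refine hmax _ ⟨fun j => ?_, h0⟩
      by_cases hj : j = i
      · subst hj; simpa using hw
      · simpa [Function.update_of_ne hj] using hvS j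

/-- If the `v i` are `n` independent shortest vectors, every vector `w` has a multiple `k w` with
`0 < k ≤ (n + 1) ^ n` in their span. By the pigeonhole principle, two of the remainders of the
multiples of `w` modulo the span agree modulo `n + 1`. Their difference is then `n + 1` times a
vector of the lattice, which is too short to be nonzero. -/
theorem exists_dvd_mul_coefficients (hn : 0 < n) (e : Basis (Fin n) ℤ L) (Q : L → ℤ)
    (hQsmul : ∀ (c : ℤ) x, Q (c • x) = c ^ 2 * Q x)
    (hQsum : ∀ v : Fin n → L, Q (∑ i, v i) ≤ n * ∑ i, Q (v i))
    (v : Fin n → L) (r : ℤ) (hr : 0 < r) (hv : ∀ i, Q (v i) = r) (hmin : ∀ x, Q x < r → x = 0)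
    (d : ℤ) (hd : d ≠ 0) (hli : LinearIndependent ℤ v) (δ : L →ₗ[ℤ] (Fin n → ℤ))
    (hδ : ∀ w, d • w = ∑ i, δ w i • v i) (w : L) :
    ∃ k : ℕ, 0 < k ∧ k ≤ (n + 1) ^ n ∧ ∀ i, d ∣ k * δ w i := by
  let R : ℕ → L := fun k => (k : ℤ) • w - ∑ i, (k * δ w i / d) • v i
  have hR : ∀ k, d • R k = ∑ i, (k * δ w i % d) • v i := by
    intro k
    simp only [R, smul_sub, smul_comm d (k : ℤ), hδ w, Finset.smul_sum, ← Finset.sum_sub_distrib,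
      smul_smul, ← sub_smul]
    refine Finset.sum_congr rfl fun i _ => ?_
    rw [Int.emod_def]
  let F : Fin ((n + 1) ^ n + 1) → (Fin n → ZMod (n + 1)) := fun k i =>
    (e.repr (R k) i : ZMod (n + 1))
  obtain ⟨k, l, hkl, hF⟩ := Fintype.exists_ne_map_eq_of_card_lt F (by simp)
  wlog hlt : k < l generalizing k l
  · exact this l k hkl.symm hF.symm (lt_of_le_of_ne (not_lt.1 hlt) hkl.symm)
  have hlt' : (k : ℕ) < l := hlt
  -- the two remainders differ by a multiple of `n + 1`, but their difference is short
  have h1 : ∀ i, ∃ u, e.repr (R l) i - e.repr (R k) i = ((n + 1 : ℕ) : ℤ) * u := fun i =>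
    (ZMod.intCast_eq_intCast_iff_dvd_sub _ _ _).1 (congrFun hF i)
  choose u hu using h1
  have h2 : R l - R k = ((n + 1 : ℕ) : ℤ) • ∑ i, u i • e i := by
    apply e.repr.injective
    ext i
    simpa [Finsupp.finsetSum_apply, Finsupp.single_apply] using hu i
  have h3 : d • (R l - R k) = ∑ i, (l * δ w i % d - k * δ w i % d) • v i := by
    rw [smul_sub, hR, hR, ← Finset.sum_sub_distrib]
    simp only [sub_smul]
  have h4 : ∀ i, (l * δ w i % d - k * δ w i % d) ^ 2 ≤ d ^ 2 := by
    intro i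
    rw [sq_le_sq, abs_le]
    have a1 := Int.emod_nonneg (l * δ w i) hd
    have a2 := Int.emod_nonneg (k * δ w i) hd
    have a3 := Int.emod_lt_abs (l * δ w i) hd
    have a4 := Int.emod_lt_abs (k * δ w i) hd
    constructor <;> omega
  have h5 : Q (d • (R l - R k)) ≤ n ^ 2 * (d ^ 2 * r) := by
    rw [h3]
    refine (hQsum _).trans ?_
    rw [pow_two, mul_assoc]
    refine mul_le_mul_of_nonneg_left ?_ (by positivity)
    calc _ ≤ ∑ i : Fin n, d ^ 2 * r := by
          refine Finset.sum_le_sum fun i _ => ?_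
          rw [hQsmul, hv]
          exact mul_le_mul_of_nonneg_right (h4 i) hr.le
      _ = n * (d ^ 2 * r) := by simp
  have h6 : R l - R k = 0 := by
    have hu0 : ∑ i, u i • e i = 0 := by
      apply hmin
      by_contra! hcon
      rw [hQsmul, h2, hQsmul] at h5
      have hd2 : 0 < d ^ 2 := by positivity
      have h7 : ((n + 1 : ℕ) : ℤ) ^ 2 * Q (∑ i, u i • e i) ≤ n ^ 2 * r :=
        le_of_mul_le_mul_left (by linarith) hd2
      have h8 : ((n + 1 : ℕ) : ℤ) ^ 2 * r ≤ n ^ 2 * r :=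
        (mul_le_mul_of_nonneg_left hcon (by positivity)).trans h7
      have h9 := le_of_mul_le_mul_right h8 hr
      push_cast at h9
      nlinarith
    rw [h2, hu0, smul_zero]
  rw [h6, smul_zero] at h3
  have h7 := Fintype.linearIndependent_iff.1 hli _ h3.symm
  refine ⟨l - k, by omega, by have := l.2; omega, fun i => ?_⟩
  rw [Nat.cast_sub hlt'.le, sub_mul]
  exact Int.dvd_of_emod_eq_zero (Int.emod_eq_emod_iff_emod_sub_eq_zero.1 (by linarith [h7 i]))

/-- An irreducible lattice of rank `n` with an action of a finite group has a basis in which the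
matrices of the action are bounded in terms of `n`. -/
theorem exists_bounded_basis_of_irreducible (n : ℕ) (hn : 0 < n) :
    ∃ C : ℕ, ∀ (L G : Type) [AddCommGroup L] [Group G] [Finite G] (_ : Basis (Fin n) ℤ L)
      (ρ : Representation ℤ G L),
      (∀ M : Submodule ℤ L, (∀ g, ∀ x ∈ M, ρ g x ∈ M) →
        (∀ (k : ℤ) (x : L), k ≠ 0 → k • x ∈ M → x ∈ M) → M = ⊥ ∨ M = ⊤) →
      ∃ b : Basis (Fin n) ℤ L, ∀ g i j, |b.repr (ρ g (b j)) i| ≤ C := by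
  let K := ((n + 1) ^ n).factorial
  have hK : 0 < K := Nat.factorial_pos _
  obtain ⟨C, hC⟩ := exists_bounded_basis_submodule n K hK
  refine ⟨C * (n * (n * C)), fun L G _ _ _ e ρ hirr => ?_⟩
  obtain ⟨Q, hQinv, hQnn, hQ0, hQsmul, hQsum, hQfin⟩ := exists_invariant_form e ρ
  obtain ⟨v₀, hv₀, hmin⟩ : ∃ v₀ : L, v₀ ≠ 0 ∧ ∀ x, Q x < Q v₀ → x = 0 := by
    have hne : {x : L | x ≠ 0}.Nonempty := ⟨e ⟨0, hn⟩, by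
      have := e.linearIndependent.ne_zero ⟨0, hn⟩; exact this⟩
    obtain ⟨v₀, hv₀, hm⟩ : ∃ v₀ ∈ {x : L | x ≠ 0}, ∀ x ∈ {x : L | x ≠ 0},
        ¬ (Q x).toNat < (Q v₀).toNat :=
      ⟨_, (measure fun x => (Q x).toNat).wf.min_mem _ hne, fun x hx =>
        (measure fun x => (Q x).toNat).wf.not_lt_min _ hx⟩
    refine ⟨v₀, hv₀, fun x hx => ?_⟩
    by_contra h0
    exact hm x h0 (by have := hQnn x; omega)
  have hr : 0 < Q v₀ := lt_of_le_of_ne (hQnn v₀) fun h => hv₀ (hQ0 _ h.symm)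
  let S : Set L := {x | Q x = Q v₀}
  have hSinv : ∀ g, ∀ x ∈ S, ρ g x ∈ S := fun g x hx => (hQinv g x).trans hx
  obtain ⟨v, d, δ, hvS, hd, hli, hδ, hδle⟩ := exists_coefficients_le e S
    ((hQfin (Q v₀)).subset fun x hx => le_of_eq hx)
    (exists_det_ne_zero e ρ hirr S hSinv v₀ rfl hv₀)
  have hdvd : ∀ w i, d ∣ K * δ w i := by
    intro w i
    obtain ⟨k, hk0, hk, hkd⟩ := exists_dvd_mul_coefficients hn e Q hQsmul hQsum v _ hr hvS
      hmin d hd hli δ hδ w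
    obtain ⟨m, hm⟩ := Nat.dvd_factorial hk0 hk
    have : (K : ℤ) = k * m := by exact_mod_cast hm
    rw [this, mul_right_comm]
    exact (hkd i).mul_right _
  -- `ψ` gives the coordinates of `K w` with respect to `v`; its image contains `Kℤⁿ`, so it is one
  -- of finitely many sublattices
  let ψ : L →ₗ[ℤ] (Fin n → ℤ) :=
    { toFun := fun w i => K * δ w i / d
      map_add' := fun x y => by
        ext i
        simp only [map_add, Pi.add_apply, mul_add]
        exact Int.add_ediv_of_dvd_left (hdvd x i)
      map_smul' := fun c x => by
        ext i
        simp only [map_smul, Pi.smul_apply, smul_eq_mul, RingHom.id_apply]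
        rw [mul_left_comm, Int.mul_ediv_assoc _ (hdvd x i)] }
  have hψd : ∀ w i, d * ψ w i = K * δ w i := fun w i => Int.mul_ediv_cancel' (hdvd w i)
  have hψ : ∀ w, (K : ℤ) • w = ∑ i, ψ w i • v i := by
    have : IsTorsionFree ℤ L := e.isTorsionFree
    intro w
    apply smul_right_injective L hd
    simp only [Finset.smul_sum, smul_smul, hψd]
    rw [mul_comm, mul_smul, hδ, Finset.smul_sum]
    simp only [smul_smul]
  have hKz : (K : ℤ) ≠ 0 := by exact_mod_cast hK.ne'
  have hψinj : Function.Injective ψ := by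
    have : IsTorsionFree ℤ L := e.isTorsionFree
    intro x y hxy
    apply smul_right_injective L hKz
    simp only [hψ, hxy]
  have hψv : ∀ i, ψ (v i) = Pi.single i (K : ℤ) := by
    intro i
    have h := hψ (v i)
    have h' : ∑ j, (ψ (v i) - Pi.single (M := fun _ => ℤ) i (K : ℤ)) j • v j = 0 := by
      simp only [Pi.sub_apply, sub_smul, Finset.sum_sub_distrib, ← h]
      simp [Pi.single_apply]
    ext j
    have := Fintype.linearIndependent_iff.1 hli _ h' j
    simpa [sub_eq_zero] using this
  have hψle : ∀ g i j, |ψ (ρ g (v j)) i| ≤ K := by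
    intro g i j
    have h1 := hψd (ρ g (v j)) i
    have h2 := hδle _ (hSinv g _ (hvS j)) i
    have h3 : |d| * |ψ (ρ g (v j)) i| ≤ |d| * K := by
      rw [← abs_mul, h1, abs_mul, mul_comm |d|]
      simpa using mul_le_mul_of_nonneg_left h2 (abs_nonneg (K : ℤ))
    exact le_of_mul_le_mul_left h3 (abs_pos.2 hd)
  obtain ⟨β, hβ, hβrepr⟩ := hC (LinearMap.range ψ) fun i => ⟨v i, hψv i⟩
  let E : L ≃ₗ[ℤ] LinearMap.range ψ := LinearEquiv.ofInjective ψ hψinj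
  refine ⟨β.map E.symm, fun g i j => ?_⟩
  let b := β.map E.symm
  have hψb : ψ (b j) = β j := by
    have : E (b j) = β j := by simp [b]
    exact congrArg Subtype.val this
  have hg : ∀ l, |ψ (ρ g (b j)) l| ≤ n * C := by
    intro l
    have h1 : (K : ℤ) * ψ (ρ g (b j)) l = ∑ m, (β j : Fin n → ℤ) m * ψ (ρ g (v m)) l := by
      have := congrArg (fun x => ψ (ρ g x) l) (hψ (b j))
      simpa only [map_smul, map_sum, Pi.smul_apply, Finset.sum_apply, smul_eq_mul, hψb] using this
    have h2 : (K : ℤ) * |ψ (ρ g (b j)) l| ≤ K * (n * C) := by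
      calc (K : ℤ) * |ψ (ρ g (b j)) l| = |∑ m, (β j : Fin n → ℤ) m * ψ (ρ g (v m)) l| := by
            rw [← h1, abs_mul, Nat.abs_cast]
        _ ≤ ∑ m, |(β j : Fin n → ℤ) m * ψ (ρ g (v m)) l| := Finset.abs_sum_le_sum_abs _ _
        _ ≤ ∑ m : Fin n, (C : ℤ) * K := by
            refine Finset.sum_le_sum fun m _ => ?_
            rw [abs_mul]
            exact mul_le_mul (hβ j m) (hψle g l m) (abs_nonneg _) (by positivity)
        _ = K * (n * C) := by simp; ring
    exact le_of_mul_le_mul_left h2 (by exact_mod_cast hK)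
  calc |b.repr (ρ g (b j)) i| = |β.repr (E (ρ g (b j))) i| := by simp [b]
    _ ≤ C * ∑ l, |ψ (ρ g (b j)) l| := hβrepr _ i
    _ ≤ C * ∑ l : Fin n, (n * C : ℤ) :=
        mul_le_mul_of_nonneg_left (Finset.sum_le_sum fun l _ => hg l) (by positivity)
    _ = (C * (n * (n * C)) : ℕ) := by simp


/-- Given bases of an invariant sublattice `M` and of `L ⧸ M` in which a finite group acts by
bounded matrices, the projection onto `L ⧸ M` has a section which is equivariant up to a bounded
error.
Averaging a section over the group makes it equivariant after multiplication by the order `N` of the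
group; the remaining freedom is used to reduce modulo `N`, and the division by `N` in the end
cancels the size of the remainders. -/
theorem exists_almost_equivariant_section [Finite G] (ρ : Representation ℤ G L)
    (M : Submodule ℤ L) (hM : ∀ g, M ≤ M.comap (ρ g)) {m k : ℕ} (b₁ : Basis (Fin m) ℤ M)
    (b₂ : Basis (Fin k) ℤ (L ⧸ M)) (C : ℕ)
    (h₁ : ∀ g i j, |b₁.repr ((ρ g).restrict (hM g) (b₁ j)) i| ≤ C)
    (h₂ : ∀ g i j, |b₂.repr (M.mapQ M (ρ g) (hM g) (b₂ j)) i| ≤ C) :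
    ∃ s : (L ⧸ M) →ₗ[ℤ] L, (∀ z, M.mkQ (s z) = z) ∧
      ∀ g j (x : M), (x : L) = ρ g (s (b₂ j)) - s (M.mapQ M (ρ g) (hM g) (b₂ j)) →
        ∀ i, |b₁.repr x i| ≤ (m + k) * C := by
  have := Fintype.ofFinite G
  have : Module.Free ℤ (L ⧸ M) := Module.Free.of_basis b₂
  obtain ⟨s₀, hs₀⟩ := Module.projective_lifting_property M.mkQ LinearMap.id M.mkQ_surjective
  have hs₀' : ∀ z, M.mkQ (s₀ z) = z := fun z => LinearMap.congr_fun hs₀ z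
  let q : G → (L ⧸ M) →ₗ[ℤ] (L ⧸ M) := fun g => M.mapQ M (ρ g) (hM g)
  have hq : ∀ g x, q g (M.mkQ x) = M.mkQ (ρ g x) := fun g x => rfl
  have hqmul : ∀ g h z, q (g * h) z = q g (q h z) := by
    intro g h z
    obtain ⟨x, rfl⟩ := M.mkQ_surjective z
    simp only [hq, map_mul, Module.End.mul_apply]
  have hq1 : ∀ z, q 1 z = z := by
    intro z
    obtain ⟨x, rfl⟩ := M.mkQ_surjective z
    simp only [hq, map_one, Module.End.one_apply]
  let N : ℤ := Fintype.card G
  have hN : 0 < N := by simp only [N]; exact_mod_cast Fintype.card_pos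
  let T : (L ⧸ M) →ₗ[ℤ] L := ∑ g : G, ρ g ∘ₗ s₀ ∘ₗ q g⁻¹
  have hTapp : ∀ z, T z = ∑ g, ρ g (s₀ (q g⁻¹ z)) := fun z => by simp [T]
  have hT : ∀ g z, ρ g (T z) = T (q g z) := by
    intro g z
    rw [hTapp, hTapp, map_sum]
    refine Fintype.sum_equiv (Equiv.mulLeft g) _ _ fun h => ?_
    simp only [Equiv.coe_mulLeft, mul_inv_rev, map_mul, Module.End.mul_apply, ← hqmul]
    simp
  have hTmod : ∀ z, M.mkQ (T z) = N • z := by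
    intro z
    rw [hTapp, map_sum]
    have : ∀ g, M.mkQ (ρ g (s₀ (q g⁻¹ z))) = z := fun g => by
      rw [← hq, hs₀', ← hqmul, mul_inv_cancel, hq1]
    rw [Finset.sum_congr rfl fun g _ => this g]
    simp [N]
  have htmem : ∀ z, (T - N • s₀) z ∈ M := by
    intro z
    refine (Submodule.Quotient.mk_eq_zero M).1 ?_
    change M.mkQ _ = 0
    simp only [LinearMap.sub_apply, LinearMap.smul_apply, map_sub, map_smul, hTmod, hs₀', sub_self]
  let t : (L ⧸ M) →ₗ[ℤ] M := (T - N • s₀).codRestrict M htmem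
  let x : (L ⧸ M) →ₗ[ℤ] M := b₂.constr ℤ fun j => ∑ i, (b₁.repr (t (b₂ j)) i / N) • b₁ i
  let y : (L ⧸ M) →ₗ[ℤ] M := t - N • x
  have hy : ∀ i j, |b₁.repr (y (b₂ j)) i| ≤ N := by
    intro i j
    have : b₁.repr (y (b₂ j)) i = b₁.repr (t (b₂ j)) i % N := by
      simp only [y, x, LinearMap.sub_apply, LinearMap.smul_apply, Basis.constr_basis, map_sub,
        map_smul, map_sum, Basis.repr_self, Finsupp.sub_apply, Finsupp.smul_apply,
        Finsupp.finsetSum_apply, Finsupp.single_apply, smul_eq_mul, Int.emod_def]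
      simp
    rw [this, abs_of_nonneg (Int.emod_nonneg _ hN.ne')]
    exact (Int.emod_lt_of_pos _ hN).le
  let s : (L ⧸ M) →ₗ[ℤ] L := s₀ + M.subtype ∘ₗ x
  have hs : ∀ z, N • s z = T z - (y z : L) := by
    intro z
    have : ((y z : M) : L) = T z - N • s₀ z - N • (x z : L) := by simp [y, t]
    rw [this]
    simp only [s, LinearMap.add_apply, LinearMap.comp_apply, Submodule.subtype_apply, smul_add]
    abel
  refine ⟨s, fun z => ?_, fun g j w hw i => ?_⟩
  · have : M.mkQ (x z : L) = 0 := by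
      rw [← LinearMap.mem_ker, Submodule.ker_mkQ]; exact (x z).2
    change M.mkQ (s₀ z + (x z : L)) = z
    rw [map_add, hs₀', this, add_zero]
  · have hNw : N • w = y (q g (b₂ j)) - (ρ g).restrict (hM g) (y (b₂ j)) := by
      apply Subtype.ext
      push_cast
      rw [hw, smul_sub, ← map_smul (ρ g), hs, hs, map_sub, hT]
      simp [q]
    have e1 : |b₁.repr (y (q g (b₂ j))) i| ≤ k * (C * N) := by
      have : y (q g (b₂ j)) = ∑ l, b₂.repr (q g (b₂ j)) l • y (b₂ l) := by
        conv_lhs => rw [← b₂.sum_repr (q g (b₂ j))]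
        simp only [map_sum, map_smul]
      rw [this]
      simp only [map_sum, map_smul, Finsupp.finsetSum_apply, Finsupp.smul_apply, smul_eq_mul]
      refine (Finset.abs_sum_le_sum_abs _ _).trans ?_
      calc _ ≤ ∑ l : Fin k, (C : ℤ) * N := by
            refine Finset.sum_le_sum fun l _ => ?_
            rw [abs_mul]
            exact mul_le_mul (h₂ g l j) (hy i l) (abs_nonneg _) (by positivity)
        _ = _ := by simp
    have e2 : |b₁.repr ((ρ g).restrict (hM g) (y (b₂ j))) i| ≤ m * (C * N) := by
      have : (ρ g).restrict (hM g) (y (b₂ j)) =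
          ∑ l, b₁.repr (y (b₂ j)) l • (ρ g).restrict (hM g) (b₁ l) := by
        conv_lhs => rw [← b₁.sum_repr (y (b₂ j))]
        simp only [map_sum, map_smul]
      rw [this]
      simp only [map_sum, map_smul, Finsupp.finsetSum_apply, Finsupp.smul_apply, smul_eq_mul]
      refine (Finset.abs_sum_le_sum_abs _ _).trans ?_
      calc _ ≤ ∑ l : Fin m, (C : ℤ) * N := by
            refine Finset.sum_le_sum fun l _ => ?_
            rw [abs_mul, mul_comm]
            exact mul_le_mul (h₁ g i l) (hy l j) (abs_nonneg _) (by positivity)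
        _ = _ := by simp
    have e3 : N * |b₁.repr w i| ≤ N * ((m + k) * C) := by
      have := congrArg (fun v => |b₁.repr v i|) hNw
      simp only [map_smul, map_sub, Finsupp.smul_apply, Finsupp.sub_apply, smul_eq_mul, abs_mul,
        abs_of_pos hN] at this
      rw [this]
      refine (abs_sub _ _).trans ?_
      linarith
    exact le_of_mul_le_mul_left e3 hN

/-- A lattice of rank `n` with an action of a finite group has a basis in which the matrices of the
action are bounded in terms of `n`. -/
theorem exists_bounded_basis (n : ℕ) :
    ∃ C : ℕ, ∀ (L G : Type) [AddCommGroup L] [Group G] [Finite G] (_ : Basis (Fin n) ℤ L)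
      (ρ : Representation ℤ G L),
      ∃ b : Basis (Fin n) ℤ L, ∀ g i j, |b.repr (ρ g (b j)) i| ≤ C := by
  induction n using Nat.strong_induction_on with
  | _ n ih =>
  rcases Nat.eq_zero_or_pos n with rfl | hn
  · exact ⟨0, fun L G _ _ _ e ρ => ⟨e, fun g i => i.elim0⟩⟩
  obtain ⟨C₀, hC₀⟩ := exists_bounded_basis_of_irreducible n hn
  choose! C hC using ih
  let D := ∑ m ∈ Finset.range n, C m
  have hD : ∀ m < n, C m ≤ D := fun m hm =>
    Finset.single_le_sum (f := C) (fun _ _ => Nat.zero_le _) (Finset.mem_range.2 hm)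
  refine ⟨C₀ + n * D, fun L G _ _ _ e ρ => ?_⟩
  by_cases hirr : ∀ M : Submodule ℤ L, (∀ g, ∀ x ∈ M, ρ g x ∈ M) →
        (∀ (k : ℤ) (x : L), k ≠ 0 → k • x ∈ M → x ∈ M) → M = ⊥ ∨ M = ⊤
  · obtain ⟨b, hb⟩ := hC₀ L G e ρ hirr
    exact ⟨b, fun g i j => (hb g i j).trans (by push_cast; nlinarith)⟩
  push Not at hirr
  obtain ⟨M, hM, hsat, hbot, htop⟩ := hirr
  have hM' : ∀ g, M ≤ M.comap (ρ g) := fun g x hx => hM g x hx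
  have : Module.Free ℤ L := Module.Free.of_basis e
  have : Module.Finite ℤ L := Module.Finite.of_basis e
  have : IsTorsionFree ℤ (L ⧸ M) := by
    refine ⟨fun k hk x y hxy => ?_⟩
    obtain ⟨x, rfl⟩ := M.mkQ_surjective x
    obtain ⟨y, rfl⟩ := M.mkQ_surjective y
    simp only [Submodule.mkQ_apply, ← Submodule.Quotient.mk_smul] at hxy ⊢
    rw [Submodule.Quotient.eq, ← smul_sub] at hxy
    exact (Submodule.Quotient.eq M).2 (hsat k _ hk.ne_zero hxy)
  have hn' : finrank ℤ L = n := by simpa using finrank_eq_card_basis e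
  have hsum := M.finrank_quotient_add_finrank
  have hm0 : 0 < finrank ℤ M := by
    have : Nontrivial M := Submodule.nontrivial_iff_ne_bot.2 hbot
    exact finrank_pos
  have hk0 : 0 < finrank ℤ (L ⧸ M) := by
    have : Nontrivial (L ⧸ M) := Submodule.Quotient.nontrivial_iff.2 htop
    exact finrank_pos
  let m := finrank ℤ M
  let k := finrank ℤ (L ⧸ M)
  have hmk : m + k = n := by omega
  obtain ⟨b₁, hb₁⟩ := hC m (by omega) M G (finBasis ℤ M) (ρ.subrepresentation M hM')
  obtain ⟨b₂, hb₂⟩ := hC k (by omega) (L ⧸ M) G (finBasis ℤ (L ⧸ M)) (ρ.quotient M hM')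
  have hb₁' : ∀ g i j, |b₁.repr ((ρ g).restrict (hM' g) (b₁ j)) i| ≤ D := fun g i j =>
    (hb₁ g i j).trans (by exact_mod_cast hD m (by omega))
  have hb₂' : ∀ g i j, |b₂.repr (M.mapQ M (ρ g) (hM' g) (b₂ j)) i| ≤ D := fun g i j =>
    (hb₂ g i j).trans (by exact_mod_cast hD k (by omega))
  obtain ⟨s, hs, hserr⟩ := exists_almost_equivariant_section ρ M hM' b₁ b₂ D hb₁' hb₂'
  have hker : ∀ z, z - s (M.mkQ z) ∈ M := fun z => by
    refine (Submodule.Quotient.mk_eq_zero M).1 ?_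
    change M.mkQ _ = 0
    rw [map_sub, hs, sub_self]
  have hmk0 : ∀ x : M, M.mkQ (x : L) = 0 := fun x => by
    rw [← LinearMap.mem_ker, Submodule.ker_mkQ]; exact x.2
  -- the section splits `L`, and in the resulting basis the group acts by block triangular matrices
  let E : L ≃ₗ[ℤ] M × (L ⧸ M) :=
    { toFun := fun z => (⟨z - s (M.mkQ z), hker z⟩, M.mkQ z)
      map_add' := fun x y => by
        ext
        · simp only [map_add, Prod.fst_add, Submodule.coe_add]; abel
        · simp only [map_add, Prod.snd_add]
      map_smul' := fun c x => by
        ext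
        · simp [smul_sub]
        · simp
      invFun := fun p => (p.1 : L) + s p.2
      left_inv := fun z => by simp
      right_inv := fun p => by
        ext
        · simp only [map_add, hmk0, hs, zero_add]; abel
        · simp only [map_add, hmk0, hs, zero_add] }
  let b : Basis (Fin m ⊕ Fin k) ℤ L := (b₁.prod b₂).map E.symm
  have hb : ∀ g i j, |b.repr (ρ g (b j)) i| ≤ n * D := by
    have hDn : (D : ℤ) ≤ n * D := by
      have : (1 : ℤ) ≤ n := by exact_mod_cast hn
      nlinarith
    have hinl : ∀ j, b (Sum.inl j) = b₁ j := fun j => by simp [b, E]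
    have hinr : ∀ j, b (Sum.inr j) = s (b₂ j) := fun j => by simp [b, E]
    have hrl : ∀ z i, b.repr z (Sum.inl i) = b₁.repr ⟨z - s (M.mkQ z), hker z⟩ i := fun z i => by
      simp [b, E]
    have hrr : ∀ z i, b.repr z (Sum.inr i) = b₂.repr (M.mkQ z) i := fun z i => by
      simp [b, E]
    rintro g (i | i) (j | j)
    · rw [hrl, hinl]
      refine le_trans (le_of_eq ?_) ((hb₁' g i j).trans hDn)
      congr 3
      apply Subtype.ext
      have : M.mkQ (ρ g (b₁ j)) = 0 := hmk0 ⟨_, hM g _ (b₁ j).2⟩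
      simp only [this, map_zero, sub_zero]
      rfl
    · rw [hrl, hinr]
      have hw : M.mkQ (ρ g (s (b₂ j))) = M.mapQ M (ρ g) (hM' g) (b₂ j) := by
        conv_rhs => rw [← hs (b₂ j)]
        rfl
      refine (hserr g j _ ?_ i).trans (le_of_eq ?_)
      · change _ - _ = _
        rw [hw]
      · rw [← hmk]; push_cast; rfl
    · rw [hrr, hinl]
      have : M.mkQ (ρ g (b₁ j)) = 0 := hmk0 ⟨_, hM g _ (b₁ j).2⟩
      rw [this]
      simp only [map_zero, Finsupp.coe_zero, Pi.zero_apply, abs_zero]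
      positivity
    · rw [hrr, hinr]
      have hw : M.mkQ (ρ g (s (b₂ j))) = M.mapQ M (ρ g) (hM' g) (b₂ j) := by
        conv_rhs => rw [← hs (b₂ j)]
        rfl
      rw [hw]
      exact (hb₂' g i j).trans hDn
  refine ⟨b.reindex (finSumFinEquiv.trans (finCongr hmk)), fun g i j => ?_⟩
  simp only [Basis.reindex_apply, Basis.repr_reindex_apply]
  exact (hb g _ _).trans (by push_cast; linarith [Nat.cast_nonneg (α := ℤ) C₀])

/-- **Jordan's theorem**: up to conjugacy, `GL_n(ℤ)` has only finitely many finite subgroups. -/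
theorem exists_finite_set_of_conjugates (n : ℕ) :
    ∃ 𝓢 : Set (Subgroup (GL (Fin n) ℤ)), 𝓢.Finite ∧ ∀ H : Subgroup (GL (Fin n) ℤ), Finite H →
      ∃ g : GL (Fin n) ℤ, H.map (MulAut.conj g).toMonoidHom ∈ 𝓢 := by
  obtain ⟨C, hC⟩ := exists_bounded_basis n
  let B : Set (GL (Fin n) ℤ) := {h | ∀ i j, |(h : Matrix (Fin n) (Fin n) ℤ) i j| ≤ C}
  have hB : B.Finite := by
    refine Set.Finite.of_finite_image (f := fun h => (h : Matrix (Fin n) (Fin n) ℤ)) ?_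
      Units.val_injective.injOn
    refine (Set.Finite.pi' (ι := Fin n) (t := fun _ => {r : Fin n → ℤ | ∀ j, r j ∈
      Set.Icc (-(C : ℤ)) C}) fun _ => Set.Finite.pi' fun _ => Set.finite_Icc _ _).subset ?_
    rintro _ ⟨h, hh, rfl⟩ i j
    exact abs_le.1 (hh i j)
  refine ⟨{H | (H : Set (GL (Fin n) ℤ)) ⊆ B}, ?_, fun H hH => ?_⟩
  · exact Set.Finite.preimage SetLike.coe_injective.injOn hB.finite_subsets
  let e := Pi.basisFun ℤ (Fin n)
  let ρ : Representation ℤ H (Fin n → ℤ) :=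
    { toFun := fun h => Matrix.toLin' ((h : GL (Fin n) ℤ) : Matrix (Fin n) (Fin n) ℤ)
      map_one' := by simp; rfl
      map_mul' := fun g h => by simp [Matrix.toLin'_mul]; rfl }
  obtain ⟨b, hb⟩ := hC (Fin n → ℤ) H e ρ
  let g : GL (Fin n) ℤ := ⟨b.toMatrix e, e.toMatrix b, b.toMatrix_mul_toMatrix_flip e,
    e.toMatrix_mul_toMatrix_flip b⟩
  refine ⟨g, ?_⟩
  rintro _ ⟨h, hh, rfl⟩ i j
  have h1 : ((g * h * g⁻¹ : GL (Fin n) ℤ) : Matrix (Fin n) (Fin n) ℤ) =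
      LinearMap.toMatrix b b (ρ ⟨h, hh⟩) := by
    rw [← basis_toMatrix_mul_linearMap_toMatrix_mul_basis_toMatrix b e b e]
    simp only [Units.val_mul]
    congr 2
    exact (LinearMap.toMatrix'_toLin' _).symm
  have h2 := hb ⟨h, hh⟩ i j
  rw [← LinearMap.toMatrix_apply, ← h1] at h2
  exact h2

end BoundedBases

/-! ### Classes of reflections -/

section Reflections

open Module

/-- Vectors in an open half space with pairwise nonpositive products are linearly independent. -/
theorem linearIndependent_of_pairwise_nonpos {V ι : Type*} [AddCommGroup V] [Fintype ι]
    (B : V →ₗ[ℤ] V →ₗ[ℤ] ℤ) (hdef : ∀ v, B v v ≤ 0 → v = 0) (φ : V →ₗ[ℤ] ℚ) (α : ι → V)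
    (hφ : ∀ i, 0 < φ (α i)) (hα : ∀ i j, i ≠ j → B (α i) (α j) ≤ 0) :
    LinearIndependent ℤ α := by
  rw [Fintype.linearIndependent_iff]
  intro c hc
  -- a vanishing combination of vectors of a half space has no positive coefficients
  have pos : ∀ p : ι → ℤ, (∀ i, 0 ≤ p i) → ∑ i, p i • α i = 0 → ∀ i, p i = 0 := by
    intro p hp h0
    have h1 : ∑ i, (p i : ℚ) * φ (α i) = 0 := by
      have := congrArg φ h0
      simpa using this
    intro i
    have h2 := (Finset.sum_eq_zero_iff_of_nonneg fun i _ =>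
      mul_nonneg (by exact_mod_cast hp i) (hφ i).le).1 h1 i (Finset.mem_univ i)
    rcases mul_eq_zero.1 h2 with h | h
    · exact_mod_cast h
    · exact absurd h (hφ i).ne'
  let p : ι → ℤ := fun i => max (c i) 0
  let m : ι → ℤ := fun i => max (-c i) 0
  have hpm : ∀ i, c i = p i - m i := fun i => by simp only [p, m]; omega
  have hp : ∀ i, 0 ≤ p i := fun i => le_max_right _ _
  have hm : ∀ i, 0 ≤ m i := fun i => le_max_right _ _
  have heq : ∑ i, p i • α i = ∑ i, m i • α i := by
    rw [← sub_eq_zero, ← Finset.sum_sub_distrib, ← hc]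
    simp only [hpm, sub_smul]
  have h0 : ∑ i, p i • α i = 0 := by
    apply hdef
    have : B (∑ i, p i • α i) (∑ j, m j • α j) ≤ 0 := by
      simp only [map_sum, map_smul, LinearMap.sum_apply, LinearMap.smul_apply, smul_eq_mul]
      simp only [Finset.mul_sum]
      refine Finset.sum_nonpos fun j _ => Finset.sum_nonpos fun i _ => ?_
      by_cases hij : i = j
      · subst hij
        have : m i = 0 ∨ p i = 0 := by simp only [p, m]; omega
        rcases this with h | h <;> simp [h]
      · have h1 := hp i
        have h2 := hm j
        have h3 := hα i j hij
        exact mul_nonpos_of_nonneg_of_nonpos h2 (mul_nonpos_of_nonneg_of_nonpos h1 h3)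
    rwa [← heq] at this
  intro i
  rw [hpm, pos p hp h0 i, pos m hm (heq ▸ h0) i, sub_zero]

/-- Choosing, in each of finitely many invariant classes of roots, a root on which a generic linear
form takes its least positive value gives linearly independent roots: two of them enclosing an acute
angle could be reflected into each other to make one of the values smaller. -/
theorem exists_linearIndependent_roots {V ι : Type*} [AddCommGroup V] [Fintype ι]
    (B : V →ₗ[ℤ] V →ₗ[ℤ] ℤ) (hsymm : ∀ v w, B v w = B w v) (hdef : ∀ v, B v v ≤ 0 → v = 0)
    (φ : V →ₗ[ℤ] ℚ) (R : ι → Set V) (hfin : ∀ i, (R i).Finite) (hne : ∀ i, (R i).Nonempty)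
    (hneg : ∀ i, ∀ β ∈ R i, -β ∈ R i) (hφ : ∀ i, ∀ β ∈ R i, φ β ≠ 0)
    (hrefl : ∀ i, ∀ β ∈ R i, ∃ f : V →ₗ[ℤ] ℤ, (∀ v, f v * B β β = -2 * B v β) ∧
      ∀ j, ∀ γ ∈ R j, γ + f γ • β ∈ R j)
    (hpar : ∀ i j, i ≠ j → ∀ β ∈ R i, ∀ γ ∈ R j, B γ γ • β ≠ B β γ • γ) :
    ∃ α : ι → V, LinearIndependent ℤ α := by
  have hmin : ∀ i, ∃ β ∈ R i, 0 < φ β ∧ ∀ γ ∈ R i, 0 < φ γ → φ β ≤ φ γ := by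
    intro i
    obtain ⟨β, ⟨h1, h2⟩, h3⟩ := Set.exists_min_image {β ∈ R i | 0 < φ β} φ
      ((hfin i).subset (Set.sep_subset _ _)) (by
        obtain ⟨β, hβ⟩ := hne i
        rcases lt_or_gt_of_ne (hφ i β hβ) with h | h
        · exact ⟨-β, hneg i β hβ, by simpa using h⟩
        · exact ⟨β, hβ, h⟩)
    exact ⟨β, h1, h2, fun γ hγ hγ0 => h3 γ ⟨hγ, hγ0⟩⟩
  choose α hαR hαpos hαmin using hmin
  refine ⟨α, linearIndependent_of_pairwise_nonpos B hdef φ α hαpos fun i j hij => ?_⟩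
  by_contra! hacute
  have hpos : ∀ i, 0 < B (α i) (α i) := by
    intro i
    by_contra! h
    have := hαpos i
    rw [hdef _ h] at this
    simp at this
  -- the reflection in `α i` sends `α j` to a root that is not smaller
  have step : ∀ i j, 0 < B (α i) (α j) → ∃ c : ℤ, 0 < c ∧ c * B (α i) (α i) = 2 * B (α i) (α j) ∧
      2 * φ (α j) ≤ c * φ (α i) := by
    intro i j hacute
    obtain ⟨f, hf, hfR⟩ := hrefl i (α i) (hαR i)
    have h1 := hf (α j)
    rw [hsymm (α j)] at h1
    have hc : 0 < -f (α j) := by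
      by_contra! h
      have := mul_nonneg (neg_nonpos.1 h) (hpos i).le
      linarith
    refine ⟨-f (α j), hc, by linarith, ?_⟩
    have h2 := hfR j (α j) (hαR j)
    have hc' : (0 : ℚ) < -f (α j) := by exact_mod_cast hc
    have h3 : φ (α j + f (α j) • α i) = φ (α j) + f (α j) * φ (α i) := by simp
    have h4 : φ (α j + f (α j) • α i) < 0 := by
      refine lt_of_le_of_ne ?_ (hφ j _ h2)
      by_contra! h
      have h5 := hαmin j _ h2 h
      rw [h3] at h5
      nlinarith [hαpos i]
    have h5 := hαmin j _ (hneg j _ h2) (by rw [map_neg]; linarith)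
    rw [map_neg, h3] at h5
    push_cast
    linarith
  obtain ⟨c, hc, hc1, hc2⟩ := step i j hacute
  obtain ⟨c', hc', hc1', hc2'⟩ := step j i (by rwa [hsymm])
  have h4 : 4 ≤ c * c' := by
    have hcq : (0 : ℚ) < c := by exact_mod_cast hc
    have : (4 : ℚ) * φ (α j) ≤ (c * c') * φ (α j) := by nlinarith
    exact_mod_cast le_of_mul_le_mul_right this (hαpos j)
  rw [hsymm (α j) (α i)] at hc1'
  have hCS : B (α i) (α i) * B (α j) (α j) ≤ B (α i) (α j) ^ 2 := by
    have h5 : (c * c') * (B (α i) (α i) * B (α j) (α j)) = 4 * B (α i) (α j) ^ 2 := by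
      linear_combination (c' * B (α j) (α j)) * hc1 + 2 * B (α i) (α j) * hc1'
    have h6 := mul_pos (hpos i) (hpos j)
    nlinarith
  refine hpar i j hij _ (hαR i) _ (hαR j) (sub_eq_zero.1 (hdef _ ?_))
  have : B (B (α j) (α j) • α i - B (α i) (α j) • α j) (B (α j) (α j) • α i - B (α i) (α j) • α j) =
      B (α j) (α j) * (B (α i) (α i) * B (α j) (α j) - B (α i) (α j) ^ 2) := by
    simp only [map_sub, map_smul, LinearMap.sub_apply, LinearMap.smul_apply, smul_eq_mul,
      hsymm (α j) (α i)]
    ring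
  rw [this]
  exact mul_nonpos_of_nonneg_of_nonpos (hpos j).le (by linarith)

variable {n : ℕ}

open Matrix

/-- An integral matrix of finite order that differs from `1` by a matrix of rank one is a
reflection. -/
theorem exists_root_of_rank_sub_one_eq_one {h : GL (Fin n) ℤ} (hfin : IsOfFinOrder h)
    (hrank : ((h : Matrix (Fin n) (Fin n) ℤ) - 1).rank = 1) :
    ∃ (α : Fin n → ℤ) (f : (Fin n → ℤ) →ₗ[ℤ] ℤ), f α = -2 ∧
      ∀ v, (h : Matrix (Fin n) (Fin n) ℤ) *ᵥ v = v + f v • α := by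
  let N := ((h : Matrix (Fin n) (Fin n) ℤ) - 1).mulVecLin
  let b : Basis (Fin 1) ℤ (LinearMap.range N) := finBasisOfFinrankEq ℤ _ hrank
  let α : Fin n → ℤ := b 0
  let f : (Fin n → ℤ) →ₗ[ℤ] ℤ := b.coord 0 ∘ₗ N.rangeRestrict
  have hα : α ≠ 0 := fun h0 => b.ne_zero 0 (Subtype.ext h0)
  have hN : ∀ v, (h : Matrix (Fin n) (Fin n) ℤ) *ᵥ v = v + f v • α := by
    intro v
    have h1 := b.sum_repr (N.rangeRestrict v)
    have h2 := congrArg Subtype.val h1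
    simp only [Finset.univ_unique, Fin.default_eq_zero, Finset.sum_singleton] at h2
    have h3 : f v • α = (h : Matrix (Fin n) (Fin n) ℤ) *ᵥ v - v := by
      refine h2.trans ?_
      simp [N]
    rw [h3]; abel
  refine ⟨α, f, ?_, hN⟩
  obtain ⟨k, hk, hk1⟩ := isOfFinOrder_iff_pow_eq_one.1 hfin
  have hpow : ∀ v, ((h : Matrix (Fin n) (Fin n) ℤ) ^ k) *ᵥ v = v := by
    intro v
    rw [← Units.val_pow_eq_pow_val, hk1]; simp
  have hαk : ∀ m : ℕ, ((h : Matrix (Fin n) (Fin n) ℤ) ^ m) *ᵥ α = (1 + f α) ^ m • α := by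
    intro m
    induction m with
    | zero => simp
    | succ m ih =>
      rw [pow_succ, ← Matrix.mulVec_mulVec, hN, Matrix.mulVec_add, Matrix.mulVec_smul, ih, pow_succ,
        mul_smul, add_smul, one_smul, smul_add, smul_comm]
  have h1 : (1 + f α) ^ k = 1 := by
    have := (hαk k).symm.trans (hpow α)
    exact smul_left_injective ℤ hα (this.trans (one_smul ℤ α).symm)
  -- the eigenvalue `1 + f α` is `1` or `-1`, and `h` is not unipotent
  rcases Int.isUnit_iff.1 (IsUnit.of_pow_eq_one h1 hk.ne') with h2 | h2
  swap
  · omega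
  exfalso
  have h3 : f α = 0 := by omega
  have hvk : ∀ (m : ℕ) v, ((h : Matrix (Fin n) (Fin n) ℤ) ^ m) *ᵥ v = v + (m * f v) • α := by
    intro m v
    induction m with
    | zero => simp
    | succ m ih =>
      rw [pow_succ', ← Matrix.mulVec_mulVec, ih, hN]
      simp only [map_add, map_smul, h3, smul_eq_mul, mul_zero, add_zero]
      push_cast
      rw [add_mul, one_mul, add_smul, add_assoc]
  have hf : ∀ v, f v = 0 := by
    intro v
    have := (hvk k v).symm.trans (hpow v)
    rw [add_eq_left, smul_eq_zero] at this
    have := this.resolve_right hα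
    rcases mul_eq_zero.1 this with h | h
    · exact absurd h (by exact_mod_cast hk.ne')
    · exact h
  obtain ⟨v, hv⟩ : ∃ v, N v = α := (b 0).2
  apply hα
  rw [← hv]
  simp [N, hN, hf]

/-- A finite group of integral matrices preserves a positive definite symmetric bilinear form. -/
theorem exists_invariant_bilinForm (H : Subgroup (GL (Fin n) ℤ)) [Finite H] :
    ∃ B : (Fin n → ℤ) →ₗ[ℤ] (Fin n → ℤ) →ₗ[ℤ] ℤ, (∀ v w, B v w = B w v) ∧
      (∀ v, B v v ≤ 0 → v = 0) ∧ ∀ h ∈ H, ∀ v w,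
        B ((h : Matrix (Fin n) (Fin n) ℤ) *ᵥ v) ((h : Matrix (Fin n) (Fin n) ℤ) *ᵥ w) = B v w := by
  have := Fintype.ofFinite H
  let B : (Fin n → ℤ) →ₗ[ℤ] (Fin n → ℤ) →ₗ[ℤ] ℤ := LinearMap.mk₂ ℤ
    (fun v w => ∑ h : H, (((h : GL (Fin n) ℤ) : Matrix (Fin n) (Fin n) ℤ) *ᵥ v) ⬝ᵥ
      (((h : GL (Fin n) ℤ) : Matrix (Fin n) (Fin n) ℤ) *ᵥ w))
    (fun v v' w => by simp [Matrix.mulVec_add, Finset.sum_add_distrib])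
    (fun c v w => by simp only [Matrix.mulVec_smul, smul_dotProduct, Finset.smul_sum])
    (fun v w w' => by simp [Matrix.mulVec_add, Finset.sum_add_distrib])
    (fun c v w => by simp only [Matrix.mulVec_smul, dotProduct_smul, Finset.smul_sum])
  refine ⟨B, fun v w => ?_, fun v hv => ?_, fun h hh v w => ?_⟩
  · simp only [B, LinearMap.mk₂_apply]
    exact Finset.sum_congr rfl fun h _ => dotProduct_comm _ _
  · have h0 : B v v = 0 := le_antisymm hv (Finset.sum_nonneg fun h _ =>
      Finset.sum_nonneg fun i _ => mul_self_nonneg _)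
    have h1 := (Finset.sum_eq_zero_iff_of_nonneg (fun h _ =>
      Finset.sum_nonneg fun i _ => mul_self_nonneg _)).1 h0 1 (Finset.mem_univ _)
    have h2 : v ⬝ᵥ v = 0 := by
      simpa only [OneMemClass.coe_one, Units.val_one, Matrix.one_mulVec, dotProduct]
        using h1
    exact dotProduct_self_eq_zero.1 h2
  · simp only [B, LinearMap.mk₂_apply, Matrix.mulVec_mulVec]
    exact Fintype.sum_equiv (Equiv.mulRight ⟨h, hh⟩) _ _ fun g => by simp

/-- A finite subgroup of `GL_n(ℤ)` has at most `n` conjugacy classes of reflections. -/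
theorem card_le_of_pairwise_not_isConj (H : Subgroup (GL (Fin n) ℤ)) [Finite H] {ι : Type}
    [Fintype ι] (r : ι → H)
    (hr : ∀ i, (((r i : H) : GL (Fin n) ℤ) - 1 : Matrix (Fin n) (Fin n) ℤ).rank = 1)
    (hconj : ∀ i j, i ≠ j → ¬ IsConj (r i) (r j)) : Fintype.card ι ≤ n := by
  let M : H → Matrix (Fin n) (Fin n) ℤ := fun h => ((h : GL (Fin n) ℤ) : Matrix (Fin n) (Fin n) ℤ)
  have hMmul : ∀ g h v, M (g * h) *ᵥ v = M g *ᵥ (M h *ᵥ v) := fun g h v => by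
    rw [Matrix.mulVec_mulVec]; rfl
  have hM1 : ∀ v, M 1 *ᵥ v = v := fun v => by simp [M]
  have hMinj : ∀ g h, (∀ v, M g *ᵥ v = M h *ᵥ v) → g = h := fun g h hgh =>
    Subtype.ext (Units.ext (Matrix.mulVec_injective (funext hgh)))
  have hroot : ∀ i, ∃ (α : Fin n → ℤ) (f : (Fin n → ℤ) →ₗ[ℤ] ℤ), f α = -2 ∧
      ∀ v, M (r i) *ᵥ v = v + f v • α := fun i =>
    exists_root_of_rank_sub_one_eq_one
      (H.subtype.isOfFinOrder (isOfFinOrder_of_finite (r i))) (hr i)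
  choose α₀ f₀ hf₀ hr₀ using hroot
  obtain ⟨B, hsymm, hdef, hinv⟩ := exists_invariant_bilinForm H
  have hinv' : ∀ (h : H) v w, B (M h *ᵥ v) (M h *ᵥ w) = B v w := fun h => hinv h h.2
  let R : ι → Set (Fin n → ℤ) := fun i => {β | ∃ g : H, β = M g *ᵥ α₀ i ∨ β = -(M g *ᵥ α₀ i)}
  -- every root has a reflection in the conjugacy class belonging to it
  have hreflR : ∀ i, ∀ β ∈ R i, ∃ (h : H) (f : (Fin n → ℤ) →ₗ[ℤ] ℤ), IsConj (r i) h ∧ f β = -2 ∧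
      ∀ v, M h *ᵥ v = v + f v • β := by
    rintro i β ⟨g, hg⟩
    have key : ∀ v, M (g * r i * g⁻¹) *ᵥ v =
        v + (f₀ i ∘ₗ (M g⁻¹).mulVecLin) v • (M g *ᵥ α₀ i) := by
      intro v
      rw [hMmul, hMmul, hr₀, Matrix.mulVec_add, ← hMmul, mul_inv_cancel, hM1, Matrix.mulVec_smul]
      rfl
    have key2 : (f₀ i ∘ₗ (M g⁻¹).mulVecLin) (M g *ᵥ α₀ i) = -2 := by
      simp only [LinearMap.comp_apply, Matrix.mulVecLin_apply]
      rw [← hMmul, inv_mul_cancel, hM1, hf₀]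
    rcases hg with rfl | rfl
    · exact ⟨g * r i * g⁻¹, _, isConj_iff.2 ⟨g, rfl⟩, key2, key⟩
    · refine ⟨g * r i * g⁻¹, -(f₀ i ∘ₗ (M g⁻¹).mulVecLin), isConj_iff.2 ⟨g, rfl⟩, ?_, fun v => ?_⟩
      · rw [LinearMap.neg_apply, map_neg, key2]; norm_num
      · rw [key v, LinearMap.neg_apply, neg_smul_neg]
  have hne0 : ∀ i, α₀ i ≠ 0 := fun i h0 => by
    have := hf₀ i
    rw [h0, map_zero] at this
    norm_num at this
  -- a reflection preserving the form is orthogonal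
  have horth : ∀ (h : H) (f : (Fin n → ℤ) →ₗ[ℤ] ℤ) (β : Fin n → ℤ), f β = -2 →
      (∀ v, M h *ᵥ v = v + f v • β) → ∀ v, f v * B β β = -2 * B v β := by
    intro h f β hβ hf v
    have h1 := hinv' h v β
    rw [hf, hf, hβ] at h1
    simp only [map_add, map_smul, LinearMap.add_apply, LinearMap.smul_apply, smul_eq_mul] at h1
    linarith
  obtain ⟨φ, hφ⟩ := Module.exists_dual_forall_apply_ne_zero (K := ℚ)
    (fun p : ι × H => fun l => ((M p.2 *ᵥ α₀ p.1) l : ℚ)) (by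
      rintro ⟨i, g⟩ h0
      apply hne0 i
      have h1 : M g *ᵥ α₀ i = 0 := by
        ext l
        have := congrFun h0 l
        simpa using this
      rw [← hM1 (α₀ i), ← inv_mul_cancel g, hMmul, h1, Matrix.mulVec_zero])
  let cast : (Fin n → ℤ) →ₗ[ℤ] (Fin n → ℚ) :=
    { toFun := fun v l => (v l : ℚ)
      map_add' := fun v w => by ext; simp
      map_smul' := fun c v => by ext; simp }
  obtain ⟨α, hα⟩ := exists_linearIndependent_roots B hsymm hdef (φ.restrictScalars ℤ ∘ₗ cast) R
    (fun i => by
      refine ((Set.finite_range fun g : H => M g *ᵥ α₀ i).union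
        (Set.finite_range fun g : H => -(M g *ᵥ α₀ i))).subset ?_
      rintro β ⟨g, rfl | rfl⟩
      · exact Or.inl ⟨g, rfl⟩
      · exact Or.inr ⟨g, rfl⟩)
    (fun i => ⟨α₀ i, 1, Or.inl (hM1 _).symm⟩)
    (by
      rintro i β ⟨g, rfl | rfl⟩
      · exact ⟨g, Or.inr rfl⟩
      · exact ⟨g, Or.inl (neg_neg _)⟩)
    (by
      rintro i β ⟨g, rfl | rfl⟩
      · exact hφ (i, g)
      · rw [map_neg, neg_ne_zero]
        exact hφ (i, g))
    (by
      intro i β hβ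
      obtain ⟨h, f, -, hfβ, hf⟩ := hreflR i β hβ
      refine ⟨f, horth h f β hfβ hf, ?_⟩
      rintro j γ ⟨g, rfl | rfl⟩
      · rw [← hf, ← hMmul]
        exact ⟨h * g, Or.inl rfl⟩
      · rw [← hf, Matrix.mulVec_neg, ← hMmul]
        exact ⟨h * g, Or.inr rfl⟩)
    (by
      intro i j hij β hβ γ hγ hpar
      obtain ⟨h, f, hc, hfβ, hf⟩ := hreflR i β hβ
      obtain ⟨h', f', hc', hfγ, hf'⟩ := hreflR j γ hγ
      apply hconj i j hij
      suffices h = h' by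
        rw [this] at hc
        exact hc.trans hc'.symm
      have hβ0 : B β β ≠ 0 := fun h0 => by
        have := hdef β h0.le
        rw [this, map_zero] at hfβ
        norm_num at hfβ
      have hγ0 : B γ γ ≠ 0 := fun h0 => by
        have := hdef γ h0.le
        rw [this, map_zero] at hfγ
        norm_num at hfγ
      refine hMinj _ _ fun v => ?_
      rw [hf, hf']
      congr 1
      have e1 := horth h f β hfβ hf v
      have e2 := horth h' f' γ hfγ hf' v
      have e3 : B γ γ * B β β = B β γ * B β γ := by
        have := congrArg (B β) hpar
        simpa only [map_smul, smul_eq_mul] using this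
      have e4 : B γ γ * B v β = B β γ * B v γ := by
        have := congrArg (B v) hpar
        simpa only [map_smul, smul_eq_mul] using this
      have hk : B β β * (B γ γ * B γ γ) ≠ 0 := mul_ne_zero hβ0 (mul_ne_zero hγ0 hγ0)
      apply smul_right_injective _ hk
      have h1 : (B β β * (B γ γ * B γ γ)) • f v • β = (B γ γ * (f v * B β β)) • (B γ γ • β) := by
        simp only [smul_smul]; congr 1; ring
      have h2 : (B β β * (B γ γ * B γ γ)) • f' v • γ =
          (B β γ * (f' v * B γ γ)) • (B β γ • γ) := by
        simp only [smul_smul]; congr 1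
        linear_combination (f' v * B γ γ) * e3
      change (B β β * (B γ γ * B γ γ)) • f v • β = (B β β * (B γ γ * B γ γ)) • f' v • γ
      rw [h1, h2, hpar, e1, e2]
      congr 1
      linear_combination (-2) * e4)
  simpa using hα.fintype_card_le_finrank

theorem malleB_le_of_malleA_eq_one (H : Subgroup (GL (Fin n) ℤ)) [Finite H] (ha : malleA H = 1) :
    malleB H ≤ n := by
  let := cyclotomicAction H
  let 𝓞s := {O : MulAction.orbitRel.Quotient GalQ (ConjClasses H) |
    ∃ h : H, ConjClasses.mk h ∈ O.orbit ∧
      (((h : GL (Fin n) ℤ) : Matrix (Fin n) (Fin n) ℤ) - 1).rank = malleA H}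
  have : Finite (ConjClasses H) := Quotient.finite _
  have : Finite (MulAction.orbitRel.Quotient GalQ (ConjClasses H)) := Quotient.finite _
  have := Fintype.ofFinite 𝓞s
  have hex : ∀ O : 𝓞s, ∃ h : H, ConjClasses.mk h ∈ O.1.orbit ∧
      (((h : GL (Fin n) ℤ) : Matrix (Fin n) (Fin n) ℤ) - 1).rank = malleA H := fun O => O.2
  choose r hr hr1 using hex
  have hcard : malleB H = Fintype.card 𝓞s := (Nat.card_eq_fintype_card (α := 𝓞s)) ▸ rfl
  rw [hcard]
  refine card_le_of_pairwise_not_isConj H r (fun i => (hr1 i).trans ha) fun O O' hne hc => hne ?_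
  have h1 := MulAction.orbitRel.Quotient.mem_orbit.1 (hr O)
  have h2 := MulAction.orbitRel.Quotient.mem_orbit.1 (hr O')
  rw [ConjClasses.mk_eq_mk_iff_isConj.2 hc] at h1
  exact Subtype.ext (h1.symm.trans h2)

/-- The group of diagonal matrices with entries `±1`. -/
noncomputable def signDiagonalHom (n : ℕ) : (Fin n → ℤˣ) →* GL (Fin n) ℤ :=
  (Units.map (Matrix.diagonalRingHom (Fin n) ℤ : (Fin n → ℤ) →* Matrix (Fin n) (Fin n) ℤ)).comp
    (MulEquiv.piUnits (M := fun _ : Fin n => ℤ)).symm.toMonoidHom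

theorem signDiagonalHom_coe (u : Fin n → ℤˣ) :
    (signDiagonalHom n u : Matrix (Fin n) (Fin n) ℤ) = Matrix.diagonal fun i => (u i : ℤ) := rfl

theorem signDiagonalHom_injective : Function.Injective (signDiagonalHom n) := by
  intro u v h
  have h1 := congrArg (fun g : GL (Fin n) ℤ => (g : Matrix (Fin n) (Fin n) ℤ)) h
  simp only [signDiagonalHom_coe] at h1
  ext i
  exact congrFun (Matrix.diagonal_injective h1) i

theorem rank_pos_of_ne_one (h : GL (Fin n) ℤ) (h1 : h ≠ 1) :
    0 < ((h : Matrix (Fin n) (Fin n) ℤ) - 1).rank := by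
  rw [Nat.pos_iff_ne_zero]
  intro h0
  apply h1
  have h2 : LinearMap.range ((h : Matrix (Fin n) (Fin n) ℤ) - 1).mulVecLin = ⊥ :=
    Submodule.finrank_eq_zero.1 h0
  have h3 := LinearMap.range_eq_bot.1 h2
  have h4 : (h : Matrix (Fin n) (Fin n) ℤ) - 1 = 0 := by
    apply Matrix.mulVec_injective
    funext v
    exact (LinearMap.congr_fun h3 v).trans (Matrix.zero_mulVec v).symm
  exact Units.ext (sub_eq_zero.1 h4)

theorem rank_signDiagonalHom_update (i : Fin n) :
    ((signDiagonalHom n (Function.update 1 i (-1)) : Matrix (Fin n) (Fin n) ℤ) - 1).rank = 1 := by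
  apply le_antisymm
  · have : (signDiagonalHom n (Function.update 1 i (-1)) : Matrix (Fin n) (Fin n) ℤ) - 1 =
        Matrix.vecMulVec (Pi.single i (-2)) (Pi.single i 1) := by
      ext k l
      rw [signDiagonalHom_coe, Matrix.sub_apply, Matrix.vecMulVec_apply, Matrix.diagonal_apply,
        Matrix.one_apply]
      by_cases hk : k = i
      · subst hk
        by_cases hl : k = l
        · subst hl; simp
        · simp [hl, Ne.symm hl]
      · by_cases hl : k = l
        · subst hl; simp [hk]
        · simp [hk, hl]
    rw [this]
    exact Matrix.rank_vecMulVec_le _ _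
  · refine rank_pos_of_ne_one _ fun h => ?_
    have := signDiagonalHom_injective (h.trans (map_one _).symm)
    have := congrFun this i
    simp at this

theorem malleA_range_signDiagonalHom (hn : 1 ≤ n) : malleA (signDiagonalHom n).range = 1 := by
  apply le_antisymm
  · refine Nat.sInf_le ⟨_, ⟨Function.update 1 ⟨0, hn⟩ (-1), rfl⟩, fun h => ?_,
      (rank_signDiagonalHom_update _).symm⟩
    have := rank_signDiagonalHom_update (n := n) ⟨0, hn⟩
    rw [h] at this
    simp at this
  · refine le_csInf ⟨1, _, ⟨Function.update 1 ⟨0, hn⟩ (-1), rfl⟩, fun h => ?_,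
      (rank_signDiagonalHom_update _).symm⟩ ?_
    · have := rank_signDiagonalHom_update (n := n) ⟨0, hn⟩
      rw [h] at this
      simp at this
    · rintro _ ⟨h, -, h1, rfl⟩
      exact rank_pos_of_ne_one h h1

/-- The `n` coordinate reflections lie in different Galois orbits: the group is abelian and
a power of an involution is the involution or trivial. -/
theorem le_malleB_range_signDiagonalHom (hn : 1 ≤ n) : n ≤ malleB (signDiagonalHom n).range := by
  let H := (signDiagonalHom n).range
  let := cyclotomicAction H
  let 𝓞s := {O : MulAction.orbitRel.Quotient GalQ (ConjClasses H) |
    ∃ h : H, ConjClasses.mk h ∈ O.orbit ∧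
      (((h : GL (Fin n) ℤ) : Matrix (Fin n) (Fin n) ℤ) - 1).rank = malleA H}
  have : Finite (ConjClasses H) := Quotient.finite _
  have : Finite (MulAction.orbitRel.Quotient GalQ (ConjClasses H)) := Quotient.finite _
  let s : Fin n → H := fun i => ⟨signDiagonalHom n (Function.update 1 i (-1)), _, rfl⟩
  have hs : ∀ i k, ∀ j, s j = s i ^ k → i = j := by
    intro i k j hij
    have h1 : signDiagonalHom n (Function.update 1 j (-1)) =
        signDiagonalHom n ((Function.update 1 i (-1) : Fin n → ℤˣ) ^ k) := by
      rw [map_pow]; exact congrArg Subtype.val hij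
    have h2 := congrFun (signDiagonalHom_injective h1) j
    by_contra hne
    simp [Function.update_of_ne (Ne.symm hne)] at h2
  let F : Fin n → 𝓞s := fun i => ⟨Quotient.mk'' (ConjClasses.mk (s i)), s i,
    MulAction.orbitRel.Quotient.mem_orbit.2 rfl, by
      rw [malleA_range_signDiagonalHom hn]; exact rank_signDiagonalHom_update i⟩
  have hF : Function.Injective F := by
    intro i j hij
    have h1 := congrArg Subtype.val hij
    obtain ⟨σ, hσ⟩ := MulAction.orbitRel_apply.1 (Quotient.exact h1)
    have h2 : ConjClasses.mk (s j ^ _) = ConjClasses.mk (s i) := hσ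
    obtain ⟨g, hg⟩ := isConj_iff.1 (ConjClasses.mk_eq_mk_iff_isConj.1 h2)
    have hcomm : ∀ a b : H, a * b = b * a := by
      rintro ⟨_, u, rfl⟩ ⟨_, v, rfl⟩
      apply Subtype.ext
      change signDiagonalHom n u * signDiagonalHom n v = signDiagonalHom n v * signDiagonalHom n u
      rw [← map_mul, mul_comm, map_mul]
    rw [hcomm g, mul_inv_cancel_right] at hg
    exact (hs j _ i hg.symm).symm
  have h1 : Nat.card (Fin n) ≤ Nat.card 𝓞s := Nat.card_le_card_of_injective F hF
  rw [Nat.card_fin] at h1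
  exact h1

end Reflections

/-! ### Tori and their character lattices -/

namespace RatTorus

open Module

variable {n : ℕ}

/-- The character group is `ℤⁿ`: the only group-like Laurent polynomials are the monomials. -/
theorem exists_charactersEquiv (T : RatTorus n) :
    Nonempty (Multiplicative (Fin n → ℤ) ≃* T.Characters) := by
  obtain ⟨e⟩ := T.split
  let φ : Multiplicative (Fin n → ℤ) →* T.Characters :=
    { toFun := fun m => ⟨e.symm (AddMonoidAlgebra.single m.toAdd 1),
        (AddMonoidAlgebra.isGroupLikeElem_single_one m.toAdd).map e.symm⟩
      map_one' := GroupLike.val_injective (map_one e.symm)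
      map_mul' := fun m m' => GroupLike.val_injective (by
        change e.symm (AddMonoidAlgebra.single (m.toAdd + m'.toAdd) 1) =
          e.symm (AddMonoidAlgebra.single m.toAdd 1) * e.symm (AddMonoidAlgebra.single m'.toAdd 1)
        rw [← map_mul, AddMonoidAlgebra.single_mul_single, one_mul]) }
  refine ⟨MulEquiv.ofBijective φ ⟨fun m m' h => ?_, fun χ => ?_⟩⟩
  · have h1 : e.symm (AddMonoidAlgebra.single m.toAdd 1) =
      e.symm (AddMonoidAlgebra.single m'.toAdd 1) := congrArg GroupLike.val h
    exact Multiplicative.toAdd.injective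
      (AddMonoidAlgebra.single_left_injective one_ne_zero (e.symm.injective h1))
  · obtain ⟨m, hm⟩ := AddMonoidAlgebra.isGroupLikeElem_iff_mem_range_single_one.1
      ((GroupLike.isGroupLikeElem_val χ).map e)
    refine ⟨Multiplicative.ofAdd m, GroupLike.val_injective ?_⟩
    change e.symm (AddMonoidAlgebra.single m 1) = GroupLike.val χ
    exact (congrArg e.symm hm).trans (e.symm_apply_apply _)

theorem nonempty_basis (T : RatTorus n) : Nonempty (Basis (Fin n) ℤ T.Lattice) := by
  obtain ⟨φ⟩ := T.exists_charactersEquiv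
  let ψ : (Fin n → ℤ) ≃+ T.Lattice := (AddEquiv.additiveMultiplicative _).symm.trans
    (MulEquiv.toAdditive φ)
  exact ⟨(Pi.basisFun ℤ (Fin n)).map ψ.toIntLinearEquiv⟩

/-- The Galois orbits on the coordinate ring over the algebraic closure are finite. -/
theorem finite_range_galMap (T : RatTorus n) (z : QBar ⊗[ℚ] T.coordRing) :
    (Set.range fun σ : GalQ => T.galMap σ z).Finite := by
  induction z with
  | zero => simp
  | add x y hx hy =>
    refine (Set.Finite.image2 (· + ·) hx hy).subset ?_
    rintro _ ⟨σ, rfl⟩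
    exact ⟨_, ⟨σ, rfl⟩, _, ⟨σ, rfl⟩, (map_add _ _ _).symm⟩
  | tmul c a =>
    refine (((minpoly ℚ c).rootSet_finite QBar).image (· ⊗ₜ[ℚ] a)).subset ?_
    rintro _ ⟨σ, rfl⟩
    refine ⟨σ c, ?_, (T.galMap_tmul σ c a).symm⟩
    have hc : IsIntegral ℚ c := Algebra.IsIntegral.isIntegral c
    rw [Polynomial.mem_rootSet_of_ne (minpoly.ne_zero hc)]
    rw [← AlgEquiv.coe_toAlgHom, Polynomial.aeval_algHom_apply, minpoly.aeval, map_zero]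

theorem matrixRep_apply (T : RatTorus n) (b : Basis (Fin n) ℤ T.Lattice) (σ : GalQ) :
    (T.matrixRep b σ : Matrix (Fin n) (Fin n) ℤ) = LinearMap.toMatrix b b (T.latticeRep σ) := rfl

theorem finite_range_matrixRep (T : RatTorus n) (b : Basis (Fin n) ℤ T.Lattice) :
    Finite (T.matrixRep b).range := by
  let S : Fin n → Set T.Lattice := fun i => Set.range fun σ : GalQ => T.latticeRep σ (b i)
  have hS : ∀ i, (S i).Finite := by
    intro i
    refine Set.Finite.of_finite_image (f := fun χ : T.Lattice => GroupLike.val (Additive.toMul χ))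
      ((T.finite_range_galMap (GroupLike.val (Additive.toMul (b i)))).subset ?_)
      (GroupLike.val_injective.comp Additive.toMul.injective).injOn
    rintro _ ⟨_, ⟨σ, rfl⟩, rfl⟩
    exact ⟨σ, rfl⟩
  have hfin : (Set.range fun (σ : GalQ) i => T.latticeRep σ (b i)).Finite :=
    (Set.Finite.pi' hS).subset (by rintro _ ⟨σ, rfl⟩ i; exact ⟨σ, rfl⟩)
  have hfin' : (Set.range fun σ : GalQ => (T.matrixRep b σ : Matrix (Fin n) (Fin n) ℤ)).Finite := by
    refine (hfin.image fun v => (fun i j => b.repr (v j) i : Matrix (Fin n) (Fin n) ℤ)).subset ?_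
    rintro _ ⟨σ, rfl⟩
    refine ⟨_, ⟨σ, rfl⟩, ?_⟩
    ext i j
    exact (LinearMap.toMatrix_apply b b (T.latticeRep σ) i j).symm
  refine Set.Finite.to_subtype (Set.Finite.of_finite_image (hfin'.subset ?_)
    Units.val_injective.injOn)
  rintro _ ⟨_, ⟨σ, rfl⟩, rfl⟩
  exact ⟨σ, rfl⟩

/-- The image of the Galois representation is finite, and it is a type of the torus. -/
theorem exists_hasType (T : RatTorus n) :
    ∃ H : Subgroup (GL (Fin n) ℤ), Finite H ∧ T.HasType H := by
  obtain ⟨b⟩ := T.nonempty_basis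
  refine ⟨_, T.finite_range_matrixRep b, b, 1, ?_⟩
  rw [map_one]
  exact Subgroup.map_id _

theorem HasType.map_conj {T : RatTorus n} {H : Subgroup (GL (Fin n) ℤ)} (h : T.HasType H)
    (g : GL (Fin n) ℤ) : T.HasType (H.map (MulAut.conj g).toMonoidHom) := by
  obtain ⟨b, g', rfl⟩ := h
  refine ⟨b, g * g', ?_⟩
  rw [Subgroup.map_map, map_mul]
  rfl

theorem HasType.exists_map_conj_eq {T : RatTorus n} {H H' : Subgroup (GL (Fin n) ℤ)}
    (h : T.HasType H) (h' : T.HasType H') :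
    ∃ g : GL (Fin n) ℤ, H.map (MulAut.conj g).toMonoidHom = H' := by
  obtain ⟨b, g, rfl⟩ := h
  obtain ⟨b', g', rfl⟩ := h'
  let P : GL (Fin n) ℤ := ⟨b'.toMatrix b, b.toMatrix b', b'.toMatrix_mul_toMatrix_flip b,
    b.toMatrix_mul_toMatrix_flip b'⟩
  have hP : (T.matrixRep b').range = (T.matrixRep b).range.map (MulAut.conj P).toMonoidHom := by
    rw [← MonoidHom.range_comp]
    congr 1
    ext σ : 2
    change (T.matrixRep b' σ : Matrix (Fin n) (Fin n) ℤ) =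
      b'.toMatrix b * (T.matrixRep b σ : Matrix (Fin n) (Fin n) ℤ) * b.toMatrix b'
    rw [matrixRep_apply, matrixRep_apply,
      basis_toMatrix_mul_linearMap_toMatrix_mul_basis_toMatrix]
  refine ⟨g' * P * g⁻¹, ?_⟩
  rw [hP, Subgroup.map_map, Subgroup.map_map]
  congr 1
  ext x : 1
  simp [mul_assoc]

/-- An isomorphism of tori identifies the character lattices with their Galois actions. -/
theorem HasType.of_equiv {T T' : RatTorus n} (h : T ≈ T') {H : Subgroup (GL (Fin n) ℤ)}
    (hT : T.HasType H) : T'.HasType H := by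
  obtain ⟨e⟩ := h
  obtain ⟨b, g, rfl⟩ := hT
  let F : (QBar ⊗[ℚ] T.coordRing) →ₐc[QBar] (QBar ⊗[ℚ] T'.coordRing) :=
    Bialgebra.TensorProduct.map (BialgHom.id QBar QBar) (e : T.coordRing →ₐc[ℚ] T'.coordRing)
  let F' : (QBar ⊗[ℚ] T'.coordRing) →ₐc[QBar] (QBar ⊗[ℚ] T.coordRing) :=
    Bialgebra.TensorProduct.map (BialgHom.id QBar QBar) (e.symm : T'.coordRing →ₐc[ℚ] T.coordRing)
  have hF : ∀ c a, F (c ⊗ₜ a) = c ⊗ₜ e a := fun c a => rfl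
  have hF' : ∀ c a, F' (c ⊗ₜ a) = c ⊗ₜ e.symm a := fun c a => rfl
  have hFF' : ∀ z, F (F' z) = z := fun z => by
    induction z with
    | zero => simp
    | add x y hx hy => rw [map_add, map_add, hx, hy]
    | tmul c a => rw [hF', hF, BialgEquiv.apply_symm_apply]
  have hF'F : ∀ z, F' (F z) = z := fun z => by
    induction z with
    | zero => simp
    | add x y hx hy => rw [map_add, map_add, hx, hy]
    | tmul c a => rw [hF, hF', BialgEquiv.symm_apply_apply]
  have hgal : ∀ σ z, F (T.galMap σ z) = T'.galMap σ (F z) := fun σ z => by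
    induction z with
    | zero => simp
    | add x y hx hy => rw [map_add, map_add, map_add, map_add, hx, hy]
    | tmul c a => rw [galMap_tmul, hF, hF, galMap_tmul]
  let E : T.Characters ≃* T'.Characters :=
    { toFun := fun χ => ⟨F (GroupLike.val χ), (GroupLike.isGroupLikeElem_val χ).map F⟩
      invFun := fun χ => ⟨F' (GroupLike.val χ), (GroupLike.isGroupLikeElem_val χ).map F'⟩
      left_inv := fun χ => GroupLike.val_injective (hF'F _)
      right_inv := fun χ => GroupLike.val_injective (hFF' _)
      map_mul' := fun χ ψ => GroupLike.val_injective
        (map_mul F (GroupLike.val χ) (GroupLike.val ψ)) }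
  let E' : T.Lattice ≃ₗ[ℤ] T'.Lattice := (MulEquiv.toAdditive E).toIntLinearEquiv
  have hE : ∀ σ χ, E' (T.latticeRep σ χ) = T'.latticeRep σ (E' χ) := fun σ χ =>
    GroupLike.val_injective (hgal σ _)
  refine ⟨b.map E', g, ?_⟩
  congr 2
  ext σ : 2
  rw [matrixRep_apply, matrixRep_apply]
  ext i j
  simp only [LinearMap.toMatrix_apply, Basis.map_apply, ← hE, Basis.map_repr,
    LinearEquiv.trans_apply, LinearEquiv.symm_apply_apply]

end RatTorus

/-! ### Tori with trivial Galois action -/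

section SplitTori

open Module

/-- **Galois descent**: the Galois-fixed elements of `QBar ⊗ A` come from `A`. -/
theorem RatTorus.exists_one_tmul_of_fixed {n : ℕ} (T : RatTorus n) (z : QBar ⊗[ℚ] T.coordRing)
    (hz : ∀ σ, T.galMap σ z = z) : ∃ a : T.coordRing, z = 1 ⊗ₜ a := by
  let β := Basis.ofVectorSpace ℚ T.coordRing
  let b := Algebra.TensorProduct.basis QBar β
  have hrepr : ∀ σ w i, b.repr (T.galMap σ w) i = σ (b.repr w i) := by
    intro σ w i
    induction w with
    | zero => simp
    | add x y hx hy => simp only [map_add, Finsupp.add_apply, hx, hy]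
    | tmul c a => simp [b, Algebra.TensorProduct.basis_repr_tmul]
  have hfix : ∀ i, ∃ q : ℚ, algebraMap ℚ QBar q = b.repr z i := fun i =>
    (InfiniteGalois.mem_range_algebraMap_iff_fixed (k := ℚ) (K := QBar) (b.repr z i)).2 fun σ => by
      rw [← hrepr, hz]
  choose q hq using hfix
  refine ⟨∑ i ∈ (b.repr z).support, q i • β i, ?_⟩
  conv_lhs => rw [← b.linearCombination_repr z]
  rw [Finsupp.linearCombination_apply, Finsupp.sum, TensorProduct.tmul_sum]
  refine Finset.sum_congr rfl fun i _ => ?_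
  rw [← hq, algebraMap_smul, TensorProduct.tmul_smul]
  simp [b]

/-- Being group-like can be checked after extending scalars. -/
theorem isGroupLikeElem_of_one_tmul {A : Type} [CommRing A] [HopfAlgebra ℚ A] {a : A} :
    IsGroupLikeElem QBar ((1 : QBar) ⊗ₜ[ℚ] a) ↔ IsGroupLikeElem ℚ a := by
  let j : A ⊗[ℚ] A → (QBar ⊗[ℚ] A) ⊗[QBar] (QBar ⊗[ℚ] A) := fun x =>
    TensorProduct.AlgebraTensorModule.distribBaseChange ℚ QBar A A (1 ⊗ₜ x)
  have hj : Function.Injective j :=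
    (TensorProduct.AlgebraTensorModule.distribBaseChange ℚ QBar A A).injective.comp
      (Module.FaithfullyFlat.tensorProduct_mk_injective (A := ℚ) (B := QBar) (A ⊗[ℚ] A))
  have hjt : ∀ x y : A, j (x ⊗ₜ y) = (1 ⊗ₜ x) ⊗ₜ (1 ⊗ₜ y) := fun x y => by
    simp [j]
  have hjadd : ∀ x y, j (x + y) = j x + j y := fun x y => by
    simp [j, TensorProduct.tmul_add]
  have hcomul : Coalgebra.comul (R := QBar) ((1 : QBar) ⊗ₜ[ℚ] a) =
      j (Coalgebra.comul (R := ℚ) a) := by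
    simp only [TensorProduct.comul_tmul, CommSemiring.comul_apply]
    induction (Coalgebra.comul (R := ℚ) a) with
    | zero => simp [j]
    | add x y hx hy => simp only [TensorProduct.tmul_add, map_add, hx, hy, hjadd]
    | tmul x y => simp [hjt]
  have hcounit : Coalgebra.counit (R := QBar) ((1 : QBar) ⊗ₜ[ℚ] a) =
      algebraMap ℚ QBar (Coalgebra.counit (R := ℚ) a) := by
    simp [Algebra.smul_def]
  constructor
  · intro h
    refine ⟨(algebraMap ℚ QBar).injective ?_, hj ?_⟩
    · rw [← hcounit, h.counit_eq_one, map_one]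
    · rw [← hcomul, h.comul_eq_tmul_self, hjt]
  · intro h
    refine ⟨?_, ?_⟩
    · rw [hcounit, h.counit_eq_one, map_one]
    · rw [hcomul, h.comul_eq_tmul_self, hjt]

namespace RatTorus

variable {n : ℕ}

/-- The characters of a torus span its coordinate ring over the algebraic closure. -/
theorem span_characters (T : RatTorus n) :
    Submodule.span QBar {z : QBar ⊗[ℚ] T.coordRing | IsGroupLikeElem QBar z} = ⊤ := by
  obtain ⟨e⟩ := T.split
  have h := AddMonoidAlgebra.span_isGroupLikeElem (R := QBar) (A := QBar) (G := Fin n → ℤ)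
  let f : AddMonoidAlgebra QBar (Fin n → ℤ) →ₗ[QBar] (QBar ⊗[ℚ] T.coordRing) :=
    (e.symm.toAlgEquiv : _ ≃ₐ[QBar] _).toLinearMap
  have hf : LinearMap.range f = ⊤ := LinearMap.range_eq_top.2 e.symm.surjective
  rw [eq_top_iff, ← hf, LinearMap.range_eq_map, ← h, Submodule.map_span]
  refine Submodule.span_mono ?_
  rintro _ ⟨x, hx, rfl⟩
  exact IsGroupLikeElem.map e.symm hx

/-- A torus whose characters are all Galois-fixed is split: its coordinate ring is the group algebra
of its group of characters. -/
theorem exists_bialgEquiv_of_fixed (T : RatTorus n)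
    (hT : ∀ (σ : GalQ) (χ : T.Characters), σ • χ = χ) :
    Nonempty (T.coordRing ≃ₐc[ℚ] MonoidAlgebra ℚ (Multiplicative (Fin n → ℤ))) := by
  have hdesc : ∀ z : QBar ⊗[ℚ] T.coordRing, IsGroupLikeElem QBar z →
      ∃ a : T.coordRing, z = 1 ⊗ₜ a ∧ IsGroupLikeElem ℚ a := by
    intro z hz
    obtain ⟨a, rfl⟩ := T.exists_one_tmul_of_fixed z fun σ =>
      congrArg GroupLike.val (hT σ ⟨z, hz⟩)
    exact ⟨a, rfl, isGroupLikeElem_of_one_tmul.1 hz⟩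
  let G := GroupLike ℚ T.coordRing
  let ε : G →* T.Characters :=
    { toFun := fun a => ⟨1 ⊗ₜ a.val, isGroupLikeElem_of_one_tmul.2 a.isGroupLikeElem_val⟩
      map_one' := GroupLike.val_injective rfl
      map_mul' := fun a b => GroupLike.val_injective (by
        change (1 : QBar) ⊗ₜ[ℚ] (a.val * b.val) = (1 ⊗ₜ a.val) * (1 ⊗ₜ b.val)
        rw [Algebra.TensorProduct.tmul_mul_tmul, one_mul]) }
  have hε : Function.Bijective ε := by
    constructor
    · intro a b hab
      have h1 : (1 : QBar) ⊗ₜ[ℚ] a.val = 1 ⊗ₜ b.val := congrArg GroupLike.val hab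
      exact GroupLike.val_injective (Module.FaithfullyFlat.tensorProduct_mk_injective
        (A := ℚ) (B := QBar) T.coordRing h1)
    · intro χ
      obtain ⟨a, ha, hag⟩ := hdesc _ (GroupLike.isGroupLikeElem_val χ)
      exact ⟨⟨a, hag⟩, GroupLike.val_injective ha.symm⟩
  let Φ : MonoidAlgebra ℚ G →ₐc[ℚ] T.coordRing := MonoidAlgebra.liftGroupLikeBialgHom
  have hΦ : ∀ a : G, Φ (MonoidAlgebra.single a 1) = a.val := fun a => by
    refine (MonoidAlgebra.lift_single _ a (1 : ℚ)).trans ?_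
    rw [one_smul]; rfl
  have hinj : Function.Injective Φ := by
    have h1 : Function.Injective
        (Finsupp.linearCombination ℚ (GroupLike.val (R := ℚ) (A := T.coordRing))) :=
      linearIndep_groupLikeVal
    have h2 : ∀ x, Φ x = Finsupp.linearCombination ℚ
        (GroupLike.val (R := ℚ) (A := T.coordRing)) x.coeff := fun x =>
      MonoidAlgebra.lift_apply _ x
    intro x y hxy
    rw [h2, h2] at hxy
    exact MonoidAlgebra.coeff_injective (h1 hxy)
  have hsurj : Function.Surjective Φ := by
    let Φ' : MonoidAlgebra ℚ G →ₗ[ℚ] T.coordRing :=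
      (Φ : MonoidAlgebra ℚ G →ₐ[ℚ] T.coordRing).toLinearMap
    have h1 : Function.Surjective (Φ'.baseChange QBar) := by
      rw [← LinearMap.range_eq_top, eq_top_iff, ← T.span_characters, Submodule.span_le]
      intro z hz
      obtain ⟨a, rfl, ha⟩ := hdesc z hz
      refine ⟨1 ⊗ₜ MonoidAlgebra.single ⟨a, ha⟩ 1, ?_⟩
      rw [LinearMap.baseChange_tmul]
      congr 1
      exact hΦ ⟨a, ha⟩
    exact (Module.FaithfullyFlat.lTensor_surjective_iff_surjective ℚ QBar Φ').1 h1
  obtain ⟨φ⟩ := T.exists_charactersEquiv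
  exact ⟨(BialgEquiv.ofBijective Φ ⟨hinj, hsurj⟩).symm.trans
    (MonoidAlgebra.domCongrBialgEquiv ℚ ℚ ((MulEquiv.ofBijective ε hε).trans φ.symm))⟩

/-- Tori with trivial Galois action on the character lattice are isomorphic. -/
theorem equiv_of_hasType_bot {T T' : RatTorus n} (hT : T.HasType ⊥) (hT' : T'.HasType ⊥) :
    T ≈ T' := by
  have key : ∀ T : RatTorus n, T.HasType ⊥ → ∀ (σ : GalQ) (χ : T.Characters), σ • χ = χ := by
    rintro T ⟨b, g, h⟩ σ χ
    have h1 : T.matrixRep b σ = 1 := by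
      have h2 : MulAut.conj g (T.matrixRep b σ) ∈
          (T.matrixRep b).range.map (MulAut.conj g).toMonoidHom := ⟨_, ⟨σ, rfl⟩, rfl⟩
      rw [h, Subgroup.mem_bot] at h2
      simpa using h2
    have h3 : LinearMap.toMatrix b b (T.latticeRep σ) = LinearMap.toMatrix b b LinearMap.id := by
      rw [← matrixRep_apply, h1, LinearMap.toMatrix_id]; rfl
    exact LinearMap.congr_fun ((LinearMap.toMatrix b b).injective h3) (Additive.ofMul χ)
  obtain ⟨e⟩ := T.exists_bialgEquiv_of_fixed (key T hT)
  obtain ⟨e'⟩ := T'.exists_bialgEquiv_of_fixed (key T' hT')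
  exact ⟨e.trans e'.symm⟩

end RatTorus

end SplitTori

/-! ### Counting -/

section Counting

open Filter Topology Asymptotics

theorem tendsto_rpow_mul_log_pow_div_zero {s : ℝ} (hs : s ≤ 1 / 2) (k m : ℕ) :
    Tendsto (fun X : ℝ => X ^ s * Real.log X ^ k / (X * Real.log X ^ m)) atTop (𝓝 0) := by
  have h1 : Tendsto (fun X : ℝ => Real.log X ^ k / X ^ (1 / 2 : ℝ)) atTop (𝓝 0) := by
    have := (isLittleO_log_rpow_rpow_atTop (k : ℝ)
      (by norm_num : (0 : ℝ) < 1 / 2)).tendsto_div_nhds_zero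
    simpa only [Real.rpow_natCast] using this
  refine tendsto_of_tendsto_of_tendsto_of_le_of_le' tendsto_const_nhds h1 ?_ ?_
  · filter_upwards [eventually_ge_atTop 1] with X hX
    have := Real.log_nonneg hX
    positivity
  · filter_upwards [eventually_ge_atTop (Real.exp 1)] with X hX
    have hX1 : 1 ≤ X := (Real.one_le_exp zero_le_one).trans hX
    have hX0 : 0 < X := by linarith
    have hlog : 1 ≤ Real.log X := (Real.le_log_iff_exp_le hX0).2 hX
    have hX2 : X ^ (1 / 2 : ℝ) * X ^ (1 / 2 : ℝ) = X := by
      rw [← Real.rpow_add hX0]; norm_num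
    have hp : 0 < X ^ (1 / 2 : ℝ) := Real.rpow_pos_of_pos hX0 _
    have hk : 0 ≤ Real.log X ^ k := by positivity
    have hm : 1 ≤ Real.log X ^ m := one_le_pow₀ hlog
    rw [div_le_div_iff₀ (by positivity) hp]
    calc X ^ s * Real.log X ^ k * X ^ (1 / 2 : ℝ)
        ≤ X ^ (1 / 2 : ℝ) * Real.log X ^ k * X ^ (1 / 2 : ℝ) := by
          gcongr
      _ = Real.log X ^ k * X := by rw [mul_right_comm, hX2, mul_comm]
      _ ≤ Real.log X ^ k * (X * Real.log X ^ m) :=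
          mul_le_mul_of_nonneg_left (le_mul_of_one_le_right hX0.le hm) hk

theorem eventually_mul_log_pow_pos (m : ℕ) : ∀ᶠ X : ℝ in atTop, 0 < X * Real.log X ^ m := by
  filter_upwards [eventually_gt_atTop 1] with X hX
  have := Real.log_pos hX
  positivity

/-- Dividing an asymptotic `u ~ v` by a comparison function. -/
theorem tendsto_div_of_isEquivalent {u v g : ℝ → ℝ} {l : ℝ} (h : u ~[atTop] v)
    (hv : Tendsto (fun X => v X / g X) atTop (𝓝 l)) :
    Tendsto (fun X => u X / g X) atTop (𝓝 l) :=
  ((h.div (IsEquivalent.refl (u := g))).symm).tendsto_nhds hv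

variable {n : ℕ}

namespace RatTorus

/-- The isomorphism classes of tori of type `H` and conductor at most `X`. -/
def classesOfType (n : ℕ) (H : Subgroup (GL (Fin n) ℤ)) (X : ℝ) : Set (IsoClass n) :=
  {t | ∃ T : RatTorus n, (⟦T⟧ : IsoClass n) = t ∧ T.HasType H ∧ T.conductor ≤ X}

theorem classesOfType_mono (H : Subgroup (GL (Fin n) ℤ)) {X Y : ℝ} (h : X ≤ Y) :
    classesOfType n H X ⊆ classesOfType n H Y := by
  rintro t ⟨T, hT, hH, hX⟩
  exact ⟨T, hT, hH, hX.trans h⟩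

theorem classesOfType_bot_subsingleton (X : ℝ) : (classesOfType n ⊥ X).Subsingleton := by
  rintro _ ⟨T, rfl, hT, -⟩ _ ⟨T', rfl, hT', -⟩
  exact Quotient.sound (equiv_of_hasType_bot hT hT')

/-- The tori of type `H` depend only on the conjugacy class of `H`. -/
theorem classesOfType_map_conj (H : Subgroup (GL (Fin n) ℤ)) (g : GL (Fin n) ℤ) (X : ℝ) :
    classesOfType n (H.map (MulAut.conj g).toMonoidHom) X = classesOfType n H X := by
  have key : ∀ (H : Subgroup (GL (Fin n) ℤ)) (g : GL (Fin n) ℤ),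
      classesOfType n H X ⊆ classesOfType n (H.map (MulAut.conj g).toMonoidHom) X := by
    rintro H g t ⟨T, hT, hH, hX⟩
    exact ⟨T, hT, hH.map_conj g, hX⟩
  refine (key H g).antisymm' ?_
  have h := key (H.map (MulAut.conj g).toMonoidHom) g⁻¹
  rw [Subgroup.map_map] at h
  have h1 : (MulAut.conj g⁻¹).toMonoidHom.comp (MulAut.conj g).toMonoidHom =
      MonoidHom.id (GL (Fin n) ℤ) := by
    ext x : 1
    simp [mul_assoc]
  rwa [h1, Subgroup.map_id] at h

/-- Types of isomorphic tori are conjugate. -/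
theorem exists_map_conj_eq_of_mem {H H' : Subgroup (GL (Fin n) ℤ)} {X : ℝ} {t : IsoClass n}
    (h : t ∈ classesOfType n H X) (h' : t ∈ classesOfType n H' X) :
    ∃ g : GL (Fin n) ℤ, H.map (MulAut.conj g).toMonoidHom = H' := by
  obtain ⟨T, rfl, hT, -⟩ := h
  obtain ⟨T', hTT', hT', -⟩ := h'
  exact hT.exists_map_conj_eq (HasType.of_equiv (Quotient.exact hTT') hT')

/-- There are finitely many finite subgroups such that every torus has exactly one of them as its
type. -/
theorem exists_representatives (n : ℕ) : ∃ (Q : Type) (_ : Fintype Q)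
    (rep : Q → Subgroup (GL (Fin n) ℤ)), (∀ q, Finite (rep q)) ∧
      (∀ H : Subgroup (GL (Fin n) ℤ), Finite H → ∃ (q : Q) (g : GL (Fin n) ℤ),
        H.map (MulAut.conj g).toMonoidHom = rep q) ∧
      ∀ q q', (∃ g : GL (Fin n) ℤ, (rep q).map (MulAut.conj g).toMonoidHom = rep q') → q = q' := by
  obtain ⟨𝓢, hfin, h𝓢⟩ := exists_finite_set_of_conjugates n
  let r : Setoid {H : Subgroup (GL (Fin n) ℤ) // Finite H} :=
    { r := fun H H' => ∃ g : GL (Fin n) ℤ, H.1.map (MulAut.conj g).toMonoidHom = H'.1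
      iseqv :=
        { refl := fun H => ⟨1, by rw [map_one]; exact Subgroup.map_id _⟩
          symm := by
            rintro ⟨H, _⟩ ⟨_, _⟩ ⟨g, rfl⟩
            refine ⟨g⁻¹, ?_⟩
            simp only [Subgroup.map_map]
            convert Subgroup.map_id H
            ext x : 1
            simp [mul_assoc]
          trans := by
            rintro ⟨H, _⟩ ⟨_, _⟩ ⟨_, _⟩ ⟨g, rfl⟩ ⟨g', rfl⟩
            refine ⟨g' * g, ?_⟩
            simp only [Subgroup.map_map, map_mul]
            rfl } }
  choose g hg using fun q : Quotient r => h𝓢 q.out.1 q.out.2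
  have : Finite 𝓢 := hfin
  have hQ : Finite (Quotient r) := by
    refine Finite.of_injective (fun q => (⟨_, hg q⟩ : 𝓢)) fun q q' h => ?_
    have h1 : q.out.1.map (MulAut.conj (g q)).toMonoidHom =
      q'.out.1.map (MulAut.conj (g q')).toMonoidHom := congrArg Subtype.val h
    have h2 : Finite (q.out.1.map (MulAut.conj (g q)).toMonoidHom) := by
      have := q.out.2
      exact Set.Finite.image _ (Set.toFinite _)
    have e1 : r q.out ⟨_, h2⟩ := ⟨g q, rfl⟩
    have e2 : r q'.out ⟨_, h2⟩ := ⟨g q', h1.symm⟩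
    rw [← q.out_eq, ← q'.out_eq]
    exact Quotient.sound (r.trans e1 (r.symm e2))
  refine ⟨Quotient r, Fintype.ofFinite _, fun q => q.out.1, fun q => q.out.2, fun H hH => ?_, ?_⟩
  · exact ⟨Quotient.mk r ⟨H, hH⟩, r.symm (Quotient.mk_out (s := r) ⟨H, hH⟩)⟩
  · intro q q' h
    rw [← q.out_eq, ← q'.out_eq]
    exact Quotient.sound h

end RatTorus

end Counting

open Filter Topology in
theorem corollary3p6 (n : ℕ) (hn : 1 ≤ n)
    (malle : ∀ (H : Subgroup (GL (Fin n) ℤ)) [Finite H], H ≠ ⊥ →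
      ∃ c : ℝ, 0 < c ∧
        Asymptotics.IsEquivalent Filter.atTop
          (fun X : ℝ => (RatTorus.countOfType n H X : ℝ))
          (fun X : ℝ => c * X ^ (1 / (malleA H : ℝ)) * Real.log X ^ (malleB H - 1))) :
    ∃ c : ℝ, 0 < c ∧
      Asymptotics.IsEquivalent Filter.atTop
        (fun X : ℝ => (RatTorus.count n X : ℝ))
        (fun X : ℝ => c * X * Real.log X ^ (n - 1)) := by
  have hfin : ∀ (H : Subgroup (GL (Fin n) ℤ)), Finite H → ∀ X,
      (RatTorus.classesOfType n H X).Finite := by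
    intro H hH X
    by_cases hbot : H = ⊥
    · subst hbot
      exact (RatTorus.classesOfType_bot_subsingleton X).finite
    obtain ⟨c, hc, h⟩ := malle H hbot
    -- `Set.ncard` of an infinite set is `0`, which the asymptotics rule out for large bounds
    obtain ⟨φ, hφ, hφeq⟩ := Asymptotics.IsEquivalent.exists_eq_mul h
    obtain ⟨Y, hY1, hYX, hYφ, hYeq⟩ := ((eventually_gt_atTop (1 : ℝ)).and
      ((eventually_ge_atTop X).and
        ((hφ.eventually_ne one_ne_zero).and hφeq))).exists
    refine (Set.finite_of_ncard_ne_zero (s := RatTorus.classesOfType n H Y) fun h0 => ?_).subset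
      (RatTorus.classesOfType_mono H hYX)
    have h1 : (RatTorus.countOfType n H Y : ℝ) = 0 := by exact_mod_cast h0
    have hlog := Real.log_pos hY1
    have hY0 : 0 < Y := by linarith
    have hpos : 0 < c * Y ^ (1 / (malleA H : ℝ)) * Real.log Y ^ (malleB H - 1) := by positivity
    exact mul_ne_zero hYφ hpos.ne' (hYeq.symm.trans h1)
  have hlim : ∀ (H : Subgroup (GL (Fin n) ℤ)) [Finite H], ∃ l : ℝ, 0 ≤ l ∧
      Tendsto (fun X : ℝ => (RatTorus.countOfType n H X : ℝ) / (X * Real.log X ^ (n - 1))) atTop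
        (𝓝 l) ∧ (H ≠ ⊥ → malleA H = 1 → malleB H - 1 = n - 1 → 0 < l) := by
    intro H hH
    by_cases hbot : H = ⊥
    · subst hbot
      refine ⟨0, le_rfl, ?_, fun h => absurd rfl h⟩
      refine tendsto_of_tendsto_of_tendsto_of_le_of_le' tendsto_const_nhds
        (tendsto_rpow_mul_log_pow_div_zero (s := 0) (by norm_num) 0 (n - 1)) ?_ ?_
      · filter_upwards [eventually_mul_log_pow_pos (n - 1)] with X hX
        positivity
      · filter_upwards [eventually_mul_log_pow_pos (n - 1)] with X hX
        have h1 : (RatTorus.countOfType n ⊥ X : ℝ) ≤ 1 := by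
          exact_mod_cast (Set.ncard_le_one (hfin ⊥ inferInstance X)).2
            (RatTorus.classesOfType_bot_subsingleton X)
        rw [Real.rpow_zero, pow_zero, mul_one]
        exact div_le_div_of_nonneg_right h1 hX.le
    obtain ⟨c, hc, h⟩ := malle H hbot
    by_cases ha : malleA H = 1
    · have hb := malleB_le_of_malleA_eq_one H ha
      rw [ha] at h
      simp only [Nat.cast_one, div_one, Real.rpow_one] at h
      rcases (Nat.sub_le_sub_right hb 1).lt_or_eq with hlt | heq
      · refine ⟨0, le_rfl, tendsto_div_of_isEquivalent h ?_, fun _ _ h' => absurd h' hlt.ne⟩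
        have h1 : Tendsto (fun X : ℝ => c * (Real.log X ^ (n - 1 - (malleB H - 1)))⁻¹) atTop
            (𝓝 0) := by
          have := ((tendsto_pow_atTop (Nat.sub_ne_zero_of_lt hlt)).comp
            Real.tendsto_log_atTop).inv_tendsto_atTop.const_mul c
          simpa using this
        refine h1.congr' ?_
        filter_upwards [eventually_gt_atTop 1] with X hX
        have hlog := Real.log_pos hX
        rw [pow_sub₀ _ hlog.ne' hlt.le]
        field_simp
      · refine ⟨c, hc.le, tendsto_div_of_isEquivalent h ?_, fun _ _ _ => hc⟩
        refine tendsto_const_nhds.congr' ?_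
        filter_upwards [eventually_mul_log_pow_pos (n - 1)] with X hX
        rw [heq, mul_assoc, mul_div_cancel_right₀ _ hX.ne']
    · refine ⟨0, le_rfl, tendsto_div_of_isEquivalent h ?_, fun _ h' => absurd h' ha⟩
      -- `a(H)` is in fact positive, but the junk value `1 / 0 = 0` is harmless here
      have hs : 1 / (malleA H : ℝ) ≤ 1 / 2 := by
        rcases Nat.eq_zero_or_pos (malleA H) with h0 | h0
        · rw [h0]; norm_num
        · have : (2 : ℝ) ≤ malleA H := by exact_mod_cast (by omega : 2 ≤ malleA H)
          exact one_div_le_one_div_of_le (by norm_num) this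
      have := (tendsto_rpow_mul_log_pow_div_zero hs (malleB H - 1) (n - 1)).const_mul c
      simpa only [mul_zero, mul_div_assoc, mul_assoc] using this
  obtain ⟨Q, _, rep, hrepfin, hrep, hrepinj⟩ := RatTorus.exists_representatives n
  -- every torus has exactly one of the representatives as its type
  have hcount : ∀ X, RatTorus.count n X = ∑ q, RatTorus.countOfType n (rep q) X := by
    intro X
    have hunion : {t : RatTorus.IsoClass n | ∃ T : RatTorus n, (⟦T⟧ : RatTorus.IsoClass n) = t ∧
        T.conductor ≤ X} = ⋃ q, RatTorus.classesOfType n (rep q) X := by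
      ext t
      simp only [Set.mem_iUnion]
      constructor
      · rintro ⟨T, rfl, hX⟩
        obtain ⟨H, hH, hT⟩ := T.exists_hasType
        obtain ⟨q, g, hg⟩ := hrep H hH
        exact ⟨q, T, rfl, hg ▸ hT.map_conj g, hX⟩
      · rintro ⟨q, T, rfl, -, hX⟩
        exact ⟨T, rfl, hX⟩
    rw [RatTorus.count, hunion, Set.ncard_iUnion_of_finite (fun q => hfin _ (hrepfin q) X),
      finsum_eq_sum_of_fintype]
    · rfl
    · intro q q' hne
      refine Set.disjoint_left.2 fun t h h' => hne ?_
      exact hrepinj q q' (RatTorus.exists_map_conj_eq_of_mem h h')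
  choose l hl0 hl _ using fun q => @hlim (rep q) (hrepfin q)
  -- the class of the group of diagonal sign matrices contributes a positive limit
  have hsum : 0 < ∑ q, l q := by
    let D := (signDiagonalHom n).range
    have hD : Finite D := Set.finite_range (signDiagonalHom n)
    have hDa : malleA D = 1 := malleA_range_signDiagonalHom hn
    have hDb : malleB D - 1 = n - 1 := by
      rw [le_antisymm (malleB_le_of_malleA_eq_one D hDa) (le_malleB_range_signDiagonalHom hn)]
    have hDbot : D ≠ ⊥ := fun h => by
      have h1 : signDiagonalHom n (Function.update 1 ⟨0, hn⟩ (-1)) ∈ D := ⟨_, rfl⟩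
      rw [h, Subgroup.mem_bot] at h1
      have h2 := rank_signDiagonalHom_update (n := n) ⟨0, hn⟩
      rw [h1] at h2
      simp at h2
    obtain ⟨m, -, hm, hmpos⟩ := hlim D
    obtain ⟨q, g, hg⟩ := hrep D hD
    have hDq : ∀ X, RatTorus.countOfType n (rep q) X = RatTorus.countOfType n D X := fun X => by
      rw [← hg]
      exact congrArg Set.ncard (RatTorus.classesOfType_map_conj D g X)
    have hq := hl q
    simp only [hDq] at hq
    refine Finset.sum_pos' (fun q _ => hl0 q) ⟨q, Finset.mem_univ q, ?_⟩
    rw [tendsto_nhds_unique hq hm]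
    exact hmpos hDbot hDa hDb
  refine ⟨∑ q, l q, hsum, Asymptotics.isEquivalent_of_tendsto_one ?_⟩
  have h1 := (tendsto_finsetSum Finset.univ fun q _ => hl q).div_const (∑ q, l q)
  rw [div_self hsum.ne'] at h1
  refine h1.congr fun X => ?_
  rw [Pi.div_apply, hcount, ← Finset.sum_div, div_div, Nat.cast_sum]
  congr 1
  ring
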